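/- Let $K$ be a field and $V$ a $K$-vector space; all tensor products are over $K$, and $TV=\bigoplus_n V^{\otimes n}$ is the tensor algebra. **Trees.** A grading tree is a finite full binary tree; $\bullet$ is the trivial one, $t\vee u$ is the tree whose root has the subtrees $t$ (left) and $u$ (right), and $\ell(t)$ is the number of leaves of $t$. For a module $M$ put $\mathcal T M=\bigoplus_t M^{\otimes \ell(t)}$ (sum over all grading trees), with the products $M^{\otimes\ell(t)}\otimes M^{\otimes\ell(u)}\to M^{\otimes\ell(t\vee u)}$, $a\otimes b\mapsto a\vee b$, given by concatenation; $\mathcal T K$ is free on the grading trees. A generating tree $\sigma$ for $V$ is an infinite rooted tree in which every node $r$ carries a label $\sigma\langle r\rangle\in V\oplus K$ and has, for some $n\ge 1$ depending on the node, exactly $2n$ children, named $L(1),\dots,L(n),R(1),\dots,R(n)$. Given a grading tree $t$ with leaves $p_1,\dots,p_m$ from left to right, and a choice $\iota$ of a positive integer for every inner node of $t$, let $r_k$ be the sequence of symbols $L(i)$, $R(i)$ obtained from the path (a word in $L,R$) from the root of $t$ to $p_k$ by decorating each step with the integer chosen at the inner node where it starts. The homomorphism $f\colon\mathcal TK\to\mathcal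 T(V\oplus K)$ generated by $\sigma$ is given by $f(t)=\sum_\iota \sigma\langle r_1\rangle\otimes\cdots\otimes\sigma\langle r_m\rangle\in (V\oplus K)^{\otimes \ell(t)}$, the sum over those $\iota$ for which all $r_k$ are nodes of $\sigma$. For a tuple $\vec\alpha=(\alpha_1,\dots,\alpha_m)$ with each $\alpha_k$ one of the projections $\mathrm{pr}_V,\mathrm{pr}_K$ of $V\oplus K$, and with $\deg\vec\alpha$ the number of $\mathrm{pr}_V$'s in it, put $\sigma\langle t\mid\vec\alpha\rangle=\sum_\iota\alpha_1(\sigma\langle r_1\rangle)\otimes\cdots\otimes\alpha_m(\sigma\langle r_m\rangle)\in V^{\otimes\deg\vec\alpha}$. The tree $\sigma$ is weakly normal if $\sigma\langle t\mid\vec\alpha\rangle=\sigma\langle u\mid\vec\beta\rangle$ whenever $\deg\vec\alpha=\deg\vec\beta$, and normal if the subtree under each of its nodes is weakly normal. Let $\mathrm{Nor}(V)$ be the set, in fact a submodule of $\mathrm{Hom}(\mathcal TK,\mathcal T(V\oplus K))$, of all $f$ generated by a normal generating tree. **Block–Leroux.** Let $\mathrm{BL}(V)$ be the space of the linear maps $f\colon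 K[X]\to TV$ that preserve degrees and for which there are finite families $(g_i),(h_i)$ of linear maps $K[X]\to TV$ with $f(pq)=\sum_i g_i(p)h_i(q)$ for all $p,q\in K[X]$. **Claim.** 1. $\mathrm{Nor}(V)$ is a coalgebra with $\delta(f)=\sum_i g_i\otimes h_i$ for any finite families $(g_i),(h_i)$ in $\mathrm{Nor}(V)$ with $f(t\vee u)=\sum_i g_i(t)\vee h_i(u)$ for all $t,u$ (such families exist for every $f$), and $\varepsilon(f)=\mathrm{pr}_K(f(\bullet))$. $\mathrm{BL}(V)$ is a coalgebra with $\delta_{\mathrm{BL}}(f)=\sum_i g_i\otimes h_i$ for any finite families $(g_i),(h_i)$ in $\mathrm{BL}(V)$ with $f(pq)=\sum_i g_i(p)h_i(q)$ for all $p,q$ (such families exist for every $f$), and $\varepsilon_{\mathrm{BL}}(f)=f(1)$. 2. There is an isomorphism of coalgebras $\tilde\varphi\colon\mathrm{Nor}(V)\to\mathrm{BL}(V)$ such that, for every $f\in\mathrm{Nor}(V)$, $\tilde\varphi(f)(1)=\mathrm{pr}_K(f(\bullet))$ and $\tilde\varphi(f)(X^n)=\mathrm{pr}_V^{\otimes n}(f(t_n))$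 for $n\ge1$, where $t_n$ is the left comb with $n$ leaves ($t_1=\bullet$, $t_{n+1}=t_n\vee\bullet$). Moreover, for every normal generating tree $\sigma$ that generates $f$, every grading tree $t$ and every projection tuple $\vec\alpha$ for $t$, $\tilde\varphi(f)(X^{\deg\vec\alpha})=\sigma\langle t\mid\vec\alpha\rangle$. 3. $\tilde\varphi$ commutes with the projections to $V$: $\tilde\varphi(f)(X)=\mathrm{pr}_V(f(\bullet))$ for all $f\in\mathrm{Nor}(V)$. -/

import Mathlib

open scoped TensorProduct DirectSum Polynomial

universe u v

set_option linter.unusedSectionVars false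

/-! ### Grading trees and tree-tensor algebras -/

/-- Finite full binary trees: the trivial tree, and the tree whose root has the two subtrees
`t`, `u`. -/
inductive GradingTree : Type
  | triv : GradingTree
  | join : GradingTree → GradingTree → GradingTree
  deriving DecidableEq

namespace GradingTree

/-- The number of leaves. -/
def leaf : GradingTree → ℕ
  | triv => 1
  | join t u => leaf t + leaf u

/-- `comb n` is the left comb with `n + 1` leaves. -/
def comb : ℕ → GradingTree
  | 0 => triv
  | n + 1 => join (comb n) triv

theorem leaf_pos : ∀ t : GradingTree, 0 < t.leaf
  | triv => Nat.one_pos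
  | join t _ => Nat.add_pos_left (leaf_pos t) _

end GradingTree

/-- The component of the tree-tensor algebra in degree `t`: the tensor power `M^{⊗ leaf t}`. -/
abbrev TreePower (K : Type u) [CommRing K] (M : Type v) [AddCommGroup M] [Module K M]
    (t : GradingTree) : Type (max u v) :=
  ⨂[K]^(t.leaf) M

/-- The tree-tensor algebra of `M`. -/
abbrev TreeTensor (K : Type u) [CommRing K] (M : Type v) [AddCommGroup M] [Module K M] :
    Type (max u v) :=
  ⨁ t : GradingTree, TreePower K M t

/-- The product of the tree-tensor algebra: concatenation of tensors
`M^{⊗ leaf t} ⊗ M^{⊗ leaf u} → M^{⊗ leaf (join t u)}`. -/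
noncomputable def treeMul {K : Type u} [CommRing K] {M : Type v} [AddCommGroup M] [Module K M]
    {t u : GradingTree} (a : TreePower K M t) (b : TreePower K M u) :
    TreePower K M (GradingTree.join t u) :=
  TensorPower.mulEquiv (n := t.leaf) (m := u.leaf) (a ⊗ₜ[K] b)

/-- The grading tree `t`, as an element `1 ⊗ ⋯ ⊗ 1` of the tree-tensor algebra of `K`. These
elements form a basis. -/
noncomputable def treeBasis (K : Type u) [CommRing K] (t : GradingTree) : TreeTensor K K :=
  DirectSum.lof K GradingTree (TreePower K K) t (PiTensorProduct.tprod K fun _ => (1 : K))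

/-- Homomorphisms from the tree-tensor algebra of `K` to that of `V ⊕ K`. -/
abbrev TreeHom (K : Type u) [CommRing K] (V : Type v) [AddCommGroup V] [Module K V] :
    Type (max u v) :=
  TreeTensor K K →ₗ[K] TreeTensor K (V × K)

/-- The value `f(t)` of a (tree-graded) homomorphism, as an element of `(V ⊕ K)^{⊗ leaf t}`. -/
noncomputable def TreeHom.value {K : Type u} [CommRing K] {V : Type v} [AddCommGroup V]
    [Module K V] (f : TreeHom K V) (t : GradingTree) : TreePower K (V × K) t :=
  DirectSum.component K GradingTree (TreePower K (V × K)) t (f (treeBasis K t))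

/-- The value of `f` at the trivial tree, as an element of `V ⊕ K`. -/
noncomputable def TreeHom.rootValue {K : Type u} [CommRing K] {V : Type v} [AddCommGroup V]
    [Module K V] (f : TreeHom K V) : V × K :=
  PiTensorProduct.subsingletonEquiv (R := K) (s := fun _ : Fin 1 => V × K) (0 : Fin 1)
    (f.value GradingTree.triv)

/-! ### Generating trees -/

/-- The two kinds of children, `L` and `R`. -/
inductive Side : Type
  | L : Side
  | R : Side
  deriving DecidableEq

/-- Position sequences. The children `L(1), …, L(n), R(1), …, R(n)` of a node are numbered here
from `0` to `n - 1` on each side, and sequences are read from the root. -/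
abbrev Position : Type := List (Side × ℕ)

/-- Generating trees for `V`. The node at position `r` has the `2 * width r` children
`r ++ [(d, i)]`, `i < width r`, and `width r` is positive. The data at positions that are not
nodes (see `GenTree.IsNode`) are irrelevant. -/
@[ext]
structure GenTree (K : Type u) (V : Type v) : Type (max u v) where
  width : Position → ℕ
  width_pos : ∀ r, 0 < width r
  label : Position → V × K

namespace GenTree

/-- The subtree under the position `r`. -/
def subtree {K : Type u} {V : Type v} (σ : GenTree K V) (r : Position) : GenTree K V where
  width s := σ.width (r ++ s)
  width_pos s := σ.width_pos (r ++ s)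
  label s := σ.label (r ++ s)

/-- The number `n` such that the root has the children `L(1), …, L(n), R(1), …, R(n)`. -/
abbrev rootWidth {K : Type u} {V : Type v} (σ : GenTree K V) : ℕ := σ.width []

/-- The subtree under the child `(d, i)` of the root. -/
abbrev child {K : Type u} {V : Type v} (σ : GenTree K V) (d : Side) (i : ℕ) : GenTree K V :=
  σ.subtree [(d, i)]

/-- The position sequence `r` specifies a node of `σ`. -/
def IsNode {K : Type u} {V : Type v} : GenTree K V → Position → Prop
  | _, [] => True
  | σ, (d, i) :: r => i < σ.rootWidth ∧ IsNode (σ.child d i) r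

/-- The choices `ι` of a number for every inner node of the grading tree `t`, such that all the
resulting position sequences specify nodes of `σ`: the number at the root of `t` is bounded by the
width of the root of `σ`, the numbers at the nodes of the two subtrees are bounded by the widths
in the corresponding subtrees of `σ`. -/
def Choice {K : Type u} {V : Type v} : GradingTree → GenTree K V → Type
  | .triv, _ => Unit
  | .join t u, σ =>
      Σ i : Fin σ.rootWidth, Choice t (σ.child .L i) × Choice u (σ.child .R i)

/-- There are finitely many choices. -/
instance instFintypeChoice {K : Type u} {V : Type v} :
    ∀ (t : GradingTree) (σ : GenTree K V), Fintype (Choice t σ)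
  | .triv, _ => inferInstanceAs (Fintype Unit)
  | .join t u, σ =>
      let _ : ∀ i : Fin σ.rootWidth,
          Fintype (Choice t (σ.child .L i) × Choice u (σ.child .R i)) := fun i =>
        let _ := instFintypeChoice t (σ.child .L i)
        let _ := instFintypeChoice u (σ.child .R i)
        inferInstance
      inferInstanceAs
        (Fintype (Σ i : Fin σ.rootWidth, Choice t (σ.child .L i) × Choice u (σ.child .R i)))

/-- The position sequences `r_1, …, r_n` belonging to the leaves of `t`, from left to right, for a
choice `ι`: the path from the root of `t` to the leaf, each step decorated with the number that `ι`
gives to the inner node at which the step starts. -/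
def leafPosition {K : Type u} {V : Type v} :
    ∀ (t : GradingTree) (σ : GenTree K V), Choice t σ → Fin t.leaf → Position
  | .triv, _, _ => fun _ => []
  | .join t u, σ, ι =>
      Fin.append
        (fun k => (Side.L, (ι.1 : ℕ)) :: leafPosition t (σ.child .L ι.1) ι.2.1 k)
        (fun k => (Side.R, (ι.1 : ℕ)) :: leafPosition u (σ.child .R ι.1) ι.2.2 k)

/-- `∑_ι M(σ⟨r_1⟩, …, σ⟨r_n⟩)`. -/
def leafSum {K : Type u} {V : Type v} {W : Type*} [AddCommMonoid W] (σ : GenTree K V)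
    (t : GradingTree) (M : (Fin t.leaf → V × K) → W) : W :=
  ∑ ι : Choice t σ, M fun k => σ.label (leafPosition t σ ι k)

section Module

variable {K : Type u} [CommRing K] {V : Type v} [AddCommGroup V] [Module K V]

/-- `∑_ι σ⟨r_1⟩ ⊗ ⋯ ⊗ σ⟨r_n⟩`, the value at `t` of the homomorphism generated by `σ`. -/
noncomputable def treeValue (σ : GenTree K V) (t : GradingTree) : TreePower K (V × K) t :=
  σ.leafSum t fun x => PiTensorProduct.tprod K x

/-- `f` is the homomorphism generated by `σ`. -/
def Generates (σ : GenTree K V) (f : TreeHom K V) : Prop :=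
  ∀ t : GradingTree,
    f (treeBasis K t) = DirectSum.lof K GradingTree (TreePower K (V × K)) t (σ.treeValue t)

/-- The projections `pr_V` (for `true`) and `pr_K` (for `false`) of `V ⊕ K`, with values in the
degree-one and degree-zero part of the tensor algebra of `V`. -/
noncomputable def projTo (K : Type u) [CommRing K] (V : Type v) [AddCommGroup V] [Module K V] :
    Bool → V × K →ₗ[K] TensorAlgebra K V
  | true => TensorAlgebra.ι K ∘ₗ LinearMap.fst K V K
  | false => Algebra.linearMap K (TensorAlgebra K V) ∘ₗ LinearMap.snd K V K

/-- The number of `pr_V`'s in a projection tuple. -/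
def projDeg {n : ℕ} (α : Fin n → Bool) : ℕ := (Finset.univ.filter fun k => α k = true).card

/-- `σ⟨t | α⟩ = ∑_ι α_1(σ⟨r_1⟩) ⊗ ⋯ ⊗ α_n(σ⟨r_n⟩)`. The tensor product of `a` copies of `V` and
`n - a` copies of `K` is identified with `V^{⊗ a}`, the degree-`a` part of the tensor algebra;
the tensor product of the factors becomes their product. -/
noncomputable def projValue (σ : GenTree K V) (t : GradingTree) (α : Fin t.leaf → Bool) :
    TensorAlgebra K V :=
  σ.leafSum t fun x => (List.ofFn fun k => projTo K V (α k) (x k)).prod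

/-- Weakly normal generating trees: `σ⟨t | α⟩` depends only on the degree of `α`. -/
def WeaklyNormal (σ : GenTree K V) : Prop :=
  ∀ (t u : GradingTree) (α : Fin t.leaf → Bool) (β : Fin u.leaf → Bool),
    projDeg α = projDeg β → σ.projValue t α = σ.projValue u β

/-- Normal generating trees: the subtree under every node is weakly normal. -/
def Normal (σ : GenTree K V) : Prop :=
  ∀ s : Position, σ.IsNode s → (σ.subtree s).WeaklyNormal

/-! Closure of normal homomorphisms under the module operations. -/

theorem subtree_nil (σ : GenTree K V) : σ.subtree [] = σ := rfl

theorem normal_iff (σ : GenTree K V) :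
    σ.Normal ↔ σ.WeaklyNormal ∧ ∀ d i, i < σ.rootWidth → (σ.child d i).Normal := by
  constructor
  · intro h
    exact ⟨h [] trivial, fun d i hi s hs => h ((d, i) :: s) ⟨hi, hs⟩⟩
  · rintro ⟨h0, h1⟩ s hs
    match s, hs with
    | [], _ => exact h0
    | (d, i) :: s, hs => exact h1 d i hs.1 s hs.2

theorem leafSum_triv {W : Type*} [AddCommMonoid W] (σ : GenTree K V)
    (M : (Fin GradingTree.triv.leaf → V × K) → W) :
    σ.leafSum .triv M = M fun _ => σ.label [] :=
  Fintype.sum_unique (ι := Unit) _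

theorem leafSum_join {W : Type*} [AddCommMonoid W] (σ : GenTree K V) (t u : GradingTree)
    (M : (Fin (GradingTree.join t u).leaf → V × K) → W) :
    σ.leafSum (.join t u) M =
      ∑ i : Fin σ.rootWidth, (σ.child .L i).leafSum t fun x =>
        (σ.child .R i).leafSum u fun y => M (Fin.append x y) := by
  unfold leafSum
  refine (Fintype.sum_sigma _).trans (Finset.sum_congr rfl fun i _ => ?_)
  refine (Fintype.sum_prod_type _).trans ?_
  refine Finset.sum_congr rfl fun a _ => Finset.sum_congr rfl fun b _ => congrArg M ?_
  funext k
  refine Fin.addCases (fun k => ?_) (fun k => ?_) k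
  · rw [Fin.append_left]
    simp only [leafPosition]
    erw [Fin.append_left]
    rfl
  · rw [Fin.append_right]
    simp only [leafPosition]
    erw [Fin.append_right]
    rfl

/-- The tree with all widths `1` and all labels `0`. -/
def zeroTree (K : Type u) [CommRing K] (V : Type v) [AddCommGroup V] : GenTree K V where
  width _ := 1
  width_pos _ := Nat.one_pos
  label _ := 0

/-- The trees `σ` and `τ` joined at the root, with the sum of the labels there. -/
def addTree (σ τ : GenTree K V) : GenTree K V where
  width
    | [] => σ.rootWidth + τ.rootWidth
    | (d, i) :: s => if i < σ.rootWidth then σ.width ((d, i) :: s)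
        else τ.width ((d, i - σ.rootWidth) :: s)
  width_pos
    | [] => Nat.add_pos_left (σ.width_pos []) _
    | (d, i) :: s => by
        dsimp only
        split
        exacts [σ.width_pos _, τ.width_pos _]
  label
    | [] => σ.label [] + τ.label []
    | (d, i) :: s => if i < σ.rootWidth then σ.label ((d, i) :: s)
        else τ.label ((d, i - σ.rootWidth) :: s)

/-- The tree `σ` with the labels at the positions `L(i_1) ⋯ L(i_a)` multiplied by `c`. -/
def smulTree (c : K) (σ : GenTree K V) : GenTree K V where
  width := σ.width
  width_pos := σ.width_pos
  label r := if ∀ p ∈ r, p.1 = Side.L then c • σ.label r else σ.label r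

theorem addTree_child_lt (σ τ : GenTree K V) (d : Side) {i : ℕ} (h : i < σ.rootWidth) :
    (addTree σ τ).child d i = σ.child d i := by
  ext1 <;> funext s <;> simp [subtree, addTree, h]

theorem addTree_child_add (σ τ : GenTree K V) (d : Side) (i : ℕ) :
    (addTree σ τ).child d (σ.rootWidth + i) = τ.child d i := by
  ext1 <;> funext s <;> simp [subtree, addTree]

theorem smulTree_child_L (c : K) (σ : GenTree K V) (i : ℕ) :
    (smulTree c σ).child .L i = smulTree c (σ.child .L i) := by
  ext1
  · rfl
  · funext s
    have h : (∀ p ∈ (Side.L, i) :: s, p.1 = Side.L) ↔ ∀ p ∈ s, p.1 = Side.L :=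
      List.forall_mem_cons.trans (and_iff_right rfl)
    exact if_congr h rfl rfl

theorem smulTree_child_R (c : K) (σ : GenTree K V) (i : ℕ) :
    (smulTree c σ).child .R i = σ.child .R i := by
  ext1 <;> funext s <;> simp [subtree, smulTree]

theorem leafSum_zero {W : Type*} [AddCommMonoid W] (t : GradingTree)
    (M : (Fin t.leaf → V × K) → W) (hM : M 0 = 0) : (zeroTree K V).leafSum t M = 0 :=
  Finset.sum_eq_zero fun _ _ => hM

theorem leafSum_add {W : Type*} [AddCommMonoid W] (σ τ : GenTree K V) (t : GradingTree)
    (M : (Fin t.leaf → V × K) → W)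
    (hM : t = .triv → ∀ x y, M (x + y) = M x + M y) :
    (addTree σ τ).leafSum t M = σ.leafSum t M + τ.leafSum t M := by
  cases t with
  | triv =>
    rw [leafSum_triv, leafSum_triv, leafSum_triv, ← hM rfl]
    rfl
  | join t u =>
    rw [leafSum_join, leafSum_join, leafSum_join]
    have h : (addTree σ τ).rootWidth = σ.rootWidth + τ.rootWidth := rfl
    refine (Fin.sum_univ_add (a := σ.rootWidth) (b := τ.rootWidth) _).trans ?_
    congr 1
    · refine Finset.sum_congr rfl fun i _ => ?_
      simp only [Fin.val_castAdd, addTree_child_lt _ _ _ i.2]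
    · refine Finset.sum_congr rfl fun i _ => ?_
      simp only [Fin.val_natAdd, addTree_child_add]

theorem leafSum_smul {W : Type*} [AddCommMonoid W] [Module K W] (c : K) (t : GradingTree) :
    ∀ (σ : GenTree K V) (M : (Fin t.leaf → V × K) → W),
      (∀ x, M (fun k => if k.val = 0 then c • x k else x k) = c • M x) →
        (smulTree c σ).leafSum t M = c • σ.leafSum t M := by
  induction t with
  | triv =>
    intro σ M hM
    rw [leafSum_triv, leafSum_triv, ← hM]
    congr 1
    funext k
    have : k.val = 0 := Nat.lt_one_iff.1 k.2
    simp [this, smulTree]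
  | join t u iht _ =>
    intro σ M hM
    rw [leafSum_join, leafSum_join, Finset.smul_sum]
    refine Finset.sum_congr rfl fun i _ => ?_
    rw [smulTree_child_L, smulTree_child_R]
    refine iht _ _ fun x => ?_
    unfold leafSum
    rw [Finset.smul_sum]
    refine Finset.sum_congr rfl fun ι _ => ?_
    refine Eq.trans (congrArg M ?_) (hM _)
    funext k
    refine Fin.addCases (fun k => ?_) (fun k => ?_) k
    · simp [Fin.append_left]
    · have := t.leaf_pos
      simp [Fin.append_right, this.ne']

/-- The multilinear map behind `projValue`. -/
noncomputable def projMul {n : ℕ} (α : Fin n → Bool) :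
    MultilinearMap K (fun _ : Fin n => V × K) (TensorAlgebra K V) :=
  (MultilinearMap.mkPiAlgebraFin K n (TensorAlgebra K V)).compLinearMap
    fun k => projTo K V (α k)

theorem projMul_apply {n : ℕ} (α : Fin n → Bool) (x : Fin n → V × K) :
    projMul α x = (List.ofFn fun k => projTo K V (α k) (x k)).prod := by
  simp [projMul]

theorem multilinear_zero {W : Type*} [AddCommMonoid W] [Module K W] {t : GradingTree}
    (M : MultilinearMap K (fun _ : Fin t.leaf => V × K) W) : M 0 = 0 :=
  M.map_coord_zero ⟨0, t.leaf_pos⟩ rfl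

theorem multilinear_add {W : Type*} [AddCommMonoid W] [Module K W]
    (M : MultilinearMap K (fun _ : Fin GradingTree.triv.leaf => V × K) W)
    (x y : Fin GradingTree.triv.leaf → V × K) : M (x + y) = M x + M y := by
  have key : ∀ z : Fin GradingTree.triv.leaf → V × K,
      Function.update (0 : Fin GradingTree.triv.leaf → V × K) ⟨0, Nat.one_pos⟩
        (z ⟨0, Nat.one_pos⟩) = z := by
    intro z
    funext k
    have : k = ⟨0, Nat.one_pos⟩ := Fin.ext (Nat.lt_one_iff.1 k.2)
    subst this
    simp
  rw [← key (x + y), Pi.add_apply, M.map_update_add, key, key]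

theorem multilinear_smul {W : Type*} [AddCommMonoid W] [Module K W] {t : GradingTree}
    (M : MultilinearMap K (fun _ : Fin t.leaf => V × K) W) (c : K) (x : Fin t.leaf → V × K) :
    M (fun k => if k.val = 0 then c • x k else x k) = c • M x := by
  have h : (fun k : Fin t.leaf => if k.val = 0 then c • x k else x k) =
      Function.update x ⟨0, t.leaf_pos⟩ (c • x ⟨0, t.leaf_pos⟩) := by
    funext k
    by_cases hk : k.val = 0
    · have : k = ⟨0, t.leaf_pos⟩ := Fin.ext hk
      subst this
      simp
    · have : k ≠ ⟨0, t.leaf_pos⟩ := fun h => hk (congrArg Fin.val h)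
      simp [hk, Function.update_of_ne this]
  rw [h, M.map_update_smul, Function.update_eq_self]

theorem projValue_eq (σ : GenTree K V) (t : GradingTree) (α : Fin t.leaf → Bool) :
    σ.projValue t α = σ.leafSum t (projMul α) := by
  simp only [projValue, leafSum, projMul_apply]

theorem treeValue_zero (t : GradingTree) : (zeroTree K V).treeValue t = 0 :=
  leafSum_zero t _ (multilinear_zero (PiTensorProduct.tprod K))

theorem treeValue_add (σ τ : GenTree K V) (t : GradingTree) :
    (addTree σ τ).treeValue t = σ.treeValue t + τ.treeValue t :=
  leafSum_add σ τ t _ (by rintro rfl; exact multilinear_add (PiTensorProduct.tprod K))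

theorem treeValue_smul (c : K) (σ : GenTree K V) (t : GradingTree) :
    (smulTree c σ).treeValue t = c • σ.treeValue t :=
  leafSum_smul c t σ _ (multilinear_smul (PiTensorProduct.tprod K) c)

theorem projValue_zero (t : GradingTree) (α : Fin t.leaf → Bool) :
    (zeroTree K V).projValue t α = 0 := by
  rw [projValue_eq]
  exact leafSum_zero t _ (multilinear_zero _)

theorem projValue_add (σ τ : GenTree K V) (t : GradingTree) (α : Fin t.leaf → Bool) :
    (addTree σ τ).projValue t α = σ.projValue t α + τ.projValue t α := by
  simp only [projValue_eq]
  exact leafSum_add σ τ t _ (by rintro rfl; exact multilinear_add _)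

theorem projValue_smul (c : K) (σ : GenTree K V) (t : GradingTree) (α : Fin t.leaf → Bool) :
    (smulTree c σ).projValue t α = c • σ.projValue t α := by
  simp only [projValue_eq]
  exact leafSum_smul c t σ _ (multilinear_smul _ c)

theorem normal_zero : (zeroTree K V).Normal := by
  intro s _ t u α β _
  change (zeroTree K V).projValue t α = (zeroTree K V).projValue u β
  rw [projValue_zero, projValue_zero]

theorem Normal.add {σ τ : GenTree K V} (hσ : σ.Normal) (hτ : τ.Normal) :
    (addTree σ τ).Normal := by
  rw [normal_iff] at hσ hτ ⊢
  refine ⟨fun t u α β h => ?_, fun d i hi => ?_⟩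
  · rw [projValue_add, projValue_add, hσ.1 t u α β h, hτ.1 t u α β h]
  · by_cases h : i < σ.rootWidth
    · rw [addTree_child_lt _ _ _ h]
      exact hσ.2 d i h
    · obtain ⟨j, rfl⟩ := Nat.exists_eq_add_of_le (not_lt.1 h)
      rw [addTree_child_add]
      exact hτ.2 d j (Nat.lt_of_add_lt_add_left hi)

theorem Normal.smul (c : K) {σ : GenTree K V} (hσ : σ.Normal) : (smulTree c σ).Normal := by
  intro s
  induction s generalizing σ with
  | nil =>
    intro _ t u α β h
    have hw : σ.WeaklyNormal := ((normal_iff σ).1 hσ).1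
    rw [subtree_nil, projValue_smul, projValue_smul, hw t u α β h]
  | cons p s ih =>
    obtain ⟨d, i⟩ := p
    intro hs
    have hi : i < σ.rootWidth := hs.1
    have hc := ((normal_iff σ).1 hσ).2 d i hi
    change (((smulTree c σ).child d i).subtree s).WeaklyNormal
    have hs2 : ((smulTree c σ).child d i).IsNode s := hs.2
    cases d with
    | L =>
      rw [smulTree_child_L] at hs2 ⊢
      exact ih hc hs2
    | R =>
      rw [smulTree_child_R] at hs2 ⊢
      exact hc s hs2

end Module

end GenTree

/-! ### The coalgebra of normal homomorphisms -/

section Nor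

variable (K : Type u) [CommRing K] (V : Type v) [AddCommGroup V] [Module K V]

/-- The module of normal homomorphisms: those generated by a normal generating tree. -/
def Nor : Submodule K (TreeHom K V) where
  carrier := {f | ∃ σ : GenTree K V, σ.Normal ∧ σ.Generates f}
  zero_mem' := ⟨GenTree.zeroTree K V, GenTree.normal_zero, fun t => by
    rw [GenTree.treeValue_zero, map_zero, LinearMap.zero_apply]⟩
  add_mem' := by
    rintro f g ⟨σ, hσ, hf⟩ ⟨τ, hτ, hg⟩
    exact ⟨GenTree.addTree σ τ, hσ.add hτ, fun t => by
      rw [GenTree.treeValue_add, map_add, LinearMap.add_apply, hf t, hg t]⟩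
  smul_mem' := by
    rintro c f ⟨σ, hσ, hf⟩
    exact ⟨GenTree.smulTree c σ, hσ.smul c, fun t => by
      rw [GenTree.treeValue_smul, map_smul, LinearMap.smul_apply, hf t]⟩

variable {K V}

/-- `f(join t u) = ∑_i g_i(t) * h_i(u)` for all grading trees `t`, `u`. -/
def TreeSplit {n : ℕ} (f : TreeHom K V) (g h : Fin n → TreeHom K V) : Prop :=
  ∀ t u : GradingTree,
    f.value (.join t u) = ∑ i, treeMul ((g i).value t) ((h i).value u)

/-- The coalgebra structure of `Nor K V`: the comultiplication takes `f` to `∑_i g_i ⊗ h_i`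
whenever `f(join t u) = ∑_i g_i(t) * h_i(u)` for all `t`, `u`, and such families exist for all `f`;
the counit is the `K`-component of `f(triv)`. There is at most one such structure. -/
structure IsNorCoalgebra (c : Coalgebra K (Nor K V)) : Prop where
  exists_split : ∀ f : Nor K V, ∃ (n : ℕ) (g h : Fin n → Nor K V),
    TreeSplit (f : TreeHom K V) (fun i => (g i : TreeHom K V)) (fun i => (h i : TreeHom K V))
  comul_eq : ∀ (f : Nor K V) (n : ℕ) (g h : Fin n → Nor K V),
    TreeSplit (f : TreeHom K V) (fun i => (g i : TreeHom K V)) (fun i => (h i : TreeHom K V)) →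
      c.comul f = ∑ i, g i ⊗ₜ[K] h i
  counit_eq : ∀ f : Nor K V, c.counit f = (f : TreeHom K V).rootValue.2

/-- The projection of `Nor K V` to `V`: the `V`-component of `f(triv)`. -/
noncomputable def norProj (f : Nor K V) : V := (f : TreeHom K V).rootValue.1

/-- The element that is the image of `X ^ n` under the map attached to `f`: the `K`-component of
`f(triv)` for `n = 0`, and `pr_V^{⊗ n}(f(t_n))` for `n ≥ 1`, with the left comb `t_n` with
`n` leaves. -/
noncomputable def combValue (f : TreeHom K V) : ℕ → TensorAlgebra K V
  | 0 => algebraMap K (TensorAlgebra K V) f.rootValue.2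
  | n + 1 => TensorPower.toTensorAlgebra
      (PiTensorProduct.map (fun _ => LinearMap.fst K V K) (f.value (GradingTree.comb n)))

end Nor

/-! ### The Block–Leroux coalgebra -/

section BlockLeroux

variable {K : Type u} [CommRing K] {V : Type v} [AddCommGroup V] [Module K V]

/-- `f` preserves degrees. -/
def PreservesDegree (f : K[X] →ₗ[K] TensorAlgebra K V) : Prop :=
  ∀ n : ℕ, f (Polynomial.X ^ n) ∈ LinearMap.range (TensorAlgebra.ι K (M := V)) ^ n

/-- `f(p q) = ∑_i g_i(p) h_i(q)` for all polynomials `p`, `q`. -/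
def PolySplit {n : ℕ} (f : K[X] →ₗ[K] TensorAlgebra K V)
    (g h : Fin n → (K[X] →ₗ[K] TensorAlgebra K V)) : Prop :=
  ∀ p q : K[X], f (p * q) = ∑ i, g i p * h i q

variable (K V)

/-- The module of linear maps `K[X] → TV` that are representative in the sense of Block and
Leroux. -/
def BLRep : Submodule K (K[X] →ₗ[K] TensorAlgebra K V) where
  carrier := {f | PreservesDegree f ∧
    ∃ (n : ℕ) (g h : Fin n → (K[X] →ₗ[K] TensorAlgebra K V)), PolySplit f g h}
  zero_mem' := ⟨fun _ => zero_mem _, 0, 0, 0, fun _ _ => by simp⟩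
  add_mem' := by
    rintro f f2 ⟨hf, n, g, h, H⟩ ⟨hf2, n2, g2, h2, H2⟩
    refine ⟨fun k => add_mem (hf k) (hf2 k), n + n2, Fin.append g g2, Fin.append h h2,
      fun p q => ?_⟩
    simp [Fin.sum_univ_add, H p q, H2 p q]
  smul_mem' := by
    rintro c f ⟨hf, n, g, h, H⟩
    exact ⟨fun k => Submodule.smul_mem _ c (hf k), n, fun i => c • g i, h, fun p q => by
      simp [H p q, Finset.smul_sum]⟩

variable {K V}

/-- The coalgebra structure of `BLRep K V`: the comultiplication takes `f` to `∑_i g_i ⊗ h_i`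
whenever `f(p q) = ∑_i g_i(p) h_i(q)` for all `p`, `q`, and such families in `BLRep K V` exist for
all `f`; the counit is `f(1)`, an element of the degree-zero part `K` of `TV`. There is at most
one such structure. -/
structure IsBLCoalgebra (c : Coalgebra K (BLRep K V)) : Prop where
  exists_split : ∀ f : BLRep K V, ∃ (n : ℕ) (g h : Fin n → BLRep K V),
    PolySplit (f : K[X] →ₗ[K] TensorAlgebra K V) (fun i => (g i).1) (fun i => (h i).1)
  comul_eq : ∀ (f : BLRep K V) (n : ℕ) (g h : Fin n → BLRep K V),
    PolySplit (f : K[X] →ₗ[K] TensorAlgebra K V) (fun i => (g i).1) (fun i => (h i).1) →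
      c.comul f = ∑ i, g i ⊗ₜ[K] h i
  counit_eq : ∀ f : BLRep K V, algebraMap K (TensorAlgebra K V) (c.counit f) = f.1 1

/-- The projection of `BLRep K V` to `V`: the value `f(X)`, an element of the degree-one part `V`
of `TV`. -/
noncomputable def blProj (f : BLRep K V) : V := TensorAlgebra.ιInv (f.1 Polynomial.X)

/-- `f(X)` indeed is the element `blProj f` of `V`. -/
theorem ι_blProj (f : BLRep K V) : TensorAlgebra.ι K (blProj f) = f.1 Polynomial.X := by
  have h := f.2.1 1
  rw [pow_one, pow_one] at h
  obtain ⟨v, hv⟩ := h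
  rw [blProj, ← hv, TensorAlgebra.ι_leftInverse v]

end BlockLeroux

/-! Fix a basis of V. A degree-preserving map f from K[X] to TV is the same as a function F on words
in the basis letters, with finitely many nonzero values in every length: F(w) is the coefficient of
w in the value at X^|w|. If the g_i and h_i also preserve degrees, f(pq) = ∑ g_i(p) h_i(q) means
F(uw) = ∑ G_i(u) H_i(w) (`polySplit_iff_wordCoef`), so everything resembles the representative
functions on a free monoid.

The comparison map sends a normal homomorphism to its values on left combs (`combMap`). By weak
normality any tree and any projection tuple of the right degree gives the same value
(`combMap_eq_projValue`). The two sides of the root of a generating tree therefore give a splitting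
of the polynomial map, so the map lands in BL(V). It is injective because a tensor over V ⊕ K is
determined by all its projections (`eq_of_projLift`). For surjectivity, f is split again and again,
and the resulting states are labelled by (f(X), f(1)). The tree obtained has σ⟨t|α⟩ = f(X^deg α) by
induction on t (`BLSplitting.projValue_tree`), hence is normal.

Iterating requires that the parts of f can be chosen in BL(V) again (`exists_polySplit_BLRep`). This
is the hard point, since the given g_i and h_i are arbitrary linear maps whose components of various
degrees may mix. To get rid of them, TV acts on sequences by weighted shifts. Counting equations and
unknowns shows that all minors of size r + 1 of the Hankel-like matrix of weighted values of f
vanish at some place (`exists_det_weightMap_eq_zero`), and with generic weights the place can be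
moved to 0. The matrix thus has finite rank over a polynomial ring, and satisfies an identity Δ
α(m,n) = ∑ (∑ α(m,n_l) D_lj) α(m_j,n) (`exists_hankelEntry_eq`) that survives specializing the
weights far to the left. Specializations of it show that only finitely many letters occur in f
(`exists_finite_letters`) and that the left translates of F span a finite-dimensional space
(`finiteDimensional_leftTranslates`). A basis of that space provides the parts.

Both coalgebra structures come from one construction: functions on a monoid that split within their
space inherit a comultiplication dual to the product of the monoid (`exists_coalgebra_of_split`).
The comparison map carries splittings to splittings, so it respects the structures. -/

/-! ### Words in a basis -/

section Words

variable {K : Type u} [CommRing K] {V : Type v} [AddCommGroup V] [Module K V]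
variable {β : Type*} (b : Module.Basis β K V)

theorem tensorAlgebra_basis_one : b.tensorAlgebra 1 = 1 := by
  simp [Module.Basis.tensorAlgebra, FreeAlgebra.basisFreeMonoid, ← MonoidAlgebra.one_def]

theorem tensorAlgebra_basis_mul (u w : FreeMonoid β) :
    b.tensorAlgebra (u * w) = b.tensorAlgebra u * b.tensorAlgebra w := by
  simp [Module.Basis.tensorAlgebra, FreeAlgebra.basisFreeMonoid, ← map_mul]

theorem tensorAlgebra_basis_of (x : β) :
    b.tensorAlgebra (FreeMonoid.of x) = TensorAlgebra.ι K (b x) := by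
  simp [Module.Basis.tensorAlgebra, FreeAlgebra.basisFreeMonoid,
   FreeAlgebra.equivMonoidAlgebraFreeMonoid]

/-- The degree-`n` part of the tensor algebra is spanned by the words of length `n`. -/
theorem range_ι_pow_eq_span (n : ℕ) :
    LinearMap.range (TensorAlgebra.ι K (M := V)) ^ n =
      Submodule.span K (b.tensorAlgebra '' {w | w.length = n}) := by
  have h1 : LinearMap.range (TensorAlgebra.ι K (M := V)) =
      Submodule.span K (Set.range fun x => TensorAlgebra.ι K (b x)) := by
    rw [LinearMap.range_eq_map, ← b.span_eq, Submodule.map_span, ← Set.range_comp]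
    rfl
  induction n with
  | zero =>
    have : {w : FreeMonoid β | w.length = 0} = {1} := by
      ext w; simp
    rw [pow_zero, this, Set.image_singleton, tensorAlgebra_basis_one, Submodule.one_eq_span]
  | succ n ih =>
    rw [pow_succ', ih, h1, Submodule.span_mul_span]
    congr 1
    ext x
    constructor
    · rintro ⟨_, ⟨y, rfl⟩, _, ⟨w, hw, rfl⟩, rfl⟩
      have hw' : w.length = n := hw
      refine ⟨FreeMonoid.of y * w, ?_, ?_⟩
      · change (FreeMonoid.of y * w).length = n + 1
        rw [FreeMonoid.length_mul, FreeMonoid.length_of, hw', add_comm]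
      · rw [tensorAlgebra_basis_mul, tensorAlgebra_basis_of]
    · rintro ⟨w, hw, rfl⟩
      induction w using FreeMonoid.casesOn with
      | one => simp at hw
      | of_mul y w =>
        refine ⟨_, ⟨y, rfl⟩, _, ⟨w, ?_, rfl⟩, ?_⟩
        · have hw' : (FreeMonoid.of y * w).length = n + 1 := hw
          rw [FreeMonoid.length_mul, FreeMonoid.length_of] at hw'
          change w.length = n
          omega
        · rw [tensorAlgebra_basis_mul, tensorAlgebra_basis_of]

theorem coord_eq_zero_of_mem_pow {n : ℕ} {x : TensorAlgebra K V}
    (hx : x ∈ LinearMap.range (TensorAlgebra.ι K (M := V)) ^ n) {w : FreeMonoid β}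
    (hw : w.length ≠ n) : b.tensorAlgebra.coord w x = 0 := by
  rw [range_ι_pow_eq_span b] at hx
  induction hx using Submodule.span_induction with
  | mem x h =>
    obtain ⟨u, hu, rfl⟩ := h
    have : u ≠ w := by rintro rfl; exact hw hu
    rw [Module.Basis.coord_apply, Module.Basis.repr_self, Finsupp.single_eq_of_ne this.symm]
  | zero => exact map_zero _
  | add x y _ _ hx hy => rw [map_add, hx, hy, add_zero]
  | smul c x _ hx => rw [map_smul, hx, smul_zero]

theorem ext_of_mem_pow {n : ℕ} {x y : TensorAlgebra K V}
    (hx : x ∈ LinearMap.range (TensorAlgebra.ι K (M := V)) ^ n)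
    (hy : y ∈ LinearMap.range (TensorAlgebra.ι K (M := V)) ^ n)
    (h : ∀ w : FreeMonoid β, w.length = n →
      b.tensorAlgebra.coord w x = b.tensorAlgebra.coord w y) : x = y := by
  refine b.tensorAlgebra.ext_elem fun w => ?_
  by_cases hw : w.length = n
  · exact h w hw
  · exact (coord_eq_zero_of_mem_pow b hx hw).trans (coord_eq_zero_of_mem_pow b hy hw).symm

/-- Homogeneity of the left factor fixes the place where a word is cut, and a word has only one
factorization with a prefix of given length. -/
theorem coord_mul_of_mem_pow {x : TensorAlgebra K V} {u : FreeMonoid β}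
    (hx : x ∈ LinearMap.range (TensorAlgebra.ι K (M := V)) ^ u.length) (w : FreeMonoid β)
    (y : TensorAlgebra K V) :
    b.tensorAlgebra.coord (u * w) (x * y) =
      b.tensorAlgebra.coord u x * b.tensorAlgebra.coord w y := by
  rw [range_ι_pow_eq_span b] at hx
  induction hx using Submodule.span_induction with
  | mem x h =>
    obtain ⟨u', hu, rfl⟩ := h
    have hy : y ∈ Submodule.span K (Set.range b.tensorAlgebra) := by
      rw [b.tensorAlgebra.span_eq]; trivial
    induction hy using Submodule.span_induction with
    | zero => simp
    | add y z _ _ hy hz => rw [mul_add, map_add, hy, hz, map_add, mul_add]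
    | smul c y _ hy => rw [mul_smul_comm, map_smul, hy, map_smul, smul_eq_mul, smul_eq_mul,
        mul_left_comm]
    | mem y hy =>
      obtain ⟨w', rfl⟩ := hy
      rw [← tensorAlgebra_basis_mul]
      simp only [Module.Basis.coord_apply, Module.Basis.repr_self]
      have key : u' * w' = u * w ↔ u' = u ∧ w' = w :=
        ⟨fun h => List.append_inj h hu, fun h => by rw [h.1, h.2]⟩
      by_cases h1 : u' = u <;> by_cases h2 : w' = w <;> simp [key, h1, h2]
  | zero => simp
  | add x z _ _ hx hz => rw [add_mul, map_add, hx, hz, map_add, add_mul]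
  | smul c x _ hx => rw [smul_mul_assoc, map_smul, hx, map_smul, smul_eq_mul, smul_eq_mul,
      mul_assoc]

/-- The coefficient at the word `w` of the value of `f` at the power of `X` of the same length. -/
noncomputable def wordCoef (w : FreeMonoid β) : (K[X] →ₗ[K] TensorAlgebra K V) →ₗ[K] K :=
  b.tensorAlgebra.coord w ∘ₗ LinearMap.applyₗ (Polynomial.X ^ w.length)

theorem wordCoef_apply (w : FreeMonoid β) (f : K[X] →ₗ[K] TensorAlgebra K V) :
    wordCoef b w f = b.tensorAlgebra.coord w (f (Polynomial.X ^ w.length)) := rfl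

theorem PolySplit.of_pow {n : ℕ} {f : K[X] →ₗ[K] TensorAlgebra K V}
    {g h : Fin n → (K[X] →ₗ[K] TensorAlgebra K V)}
    (H : ∀ k l : ℕ, f (Polynomial.X ^ (k + l)) =
      ∑ i, g i (Polynomial.X ^ k) * h i (Polynomial.X ^ l)) : PolySplit f g h := by
  intro p q
  induction p using Polynomial.induction_on' with
  | add p p' hp hp' => simp only [add_mul, map_add, hp, hp', Finset.sum_add_distrib]
  | monomial k c =>
    induction q using Polynomial.induction_on' with
    | add q q' hq hq' => simp only [mul_add, map_add, hq, hq', Finset.sum_add_distrib]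
    | monomial l d =>
      rw [Polynomial.monomial_mul_monomial, ← Polynomial.smul_X_eq_monomial,
        ← Polynomial.smul_X_eq_monomial, ← Polynomial.smul_X_eq_monomial]
      simp only [map_smul, H, smul_mul_smul_comm, Finset.smul_sum]

theorem PreservesDegree.ext {f g : K[X] →ₗ[K] TensorAlgebra K V} (hf : PreservesDegree f)
    (hg : PreservesDegree g) (h : ∀ w, wordCoef b w f = wordCoef b w g) : f = g := by
  refine Polynomial.lhom_ext' fun n => LinearMap.ext_ring ?_
  have : f (Polynomial.X ^ n) = g (Polynomial.X ^ n) :=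
    ext_of_mem_pow b (hf n) (hg n) (by rintro w rfl; exact h w)
  simpa [← Polynomial.X_pow_eq_monomial] using this

/-- The degree conditions on the parts force the only cut of the word to be at the prescribed place;
without them the coefficient of a product sums over all cuts. -/
theorem polySplit_iff_wordCoef {n : ℕ} {f : K[X] →ₗ[K] TensorAlgebra K V}
    {g h : Fin n → (K[X] →ₗ[K] TensorAlgebra K V)} (hf : PreservesDegree f)
    (hg : ∀ i, PreservesDegree (g i)) (hh : ∀ i, PreservesDegree (h i)) :
    PolySplit f g h ↔ ∀ u w : FreeMonoid β,
      wordCoef b (u * w) f = ∑ i, wordCoef b u (g i) * wordCoef b w (h i) := by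
  constructor
  · intro H u w
    rw [wordCoef_apply, FreeMonoid.length_mul, pow_add, H, map_sum]
    exact Finset.sum_congr rfl fun i _ => coord_mul_of_mem_pow b (hg i _) _ _
  · intro H
    refine PolySplit.of_pow fun k l => ext_of_mem_pow b (hf _) ?_ fun w hw => ?_
    · refine Submodule.sum_mem _ fun i _ => ?_
      rw [pow_add]
      exact Submodule.mul_mem_mul (hg i k) (hh i l)
    · obtain ⟨u, v, rfl, rfl, rfl⟩ : ∃ u v : FreeMonoid β, w = u * v ∧ u.length = k ∧
          v.length = l := by
        refine ⟨FreeMonoid.ofList (w.toList.take k), FreeMonoid.ofList (w.toList.drop k), ?_, ?_, ?_⟩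
        · exact (List.take_append_drop k w.toList).symm
        · change (w.toList.take k).length = k
          have : w.toList.length = k + l := hw
          simp [this]
        · change (w.toList.drop k).length = l
          have : w.toList.length = k + l := hw
          simp [this]
      have := H u v
      rw [wordCoef_apply, FreeMonoid.length_mul] at this
      rw [this, map_sum]
      exact Finset.sum_congr rfl fun i _ => (coord_mul_of_mem_pow b (hg i _) _ _).symm

/-- A function on words with finitely many nonzero values in every length comes from a
degree-preserving map. -/
theorem exists_preservesDegree_of_words (F : FreeMonoid β → K)
    (hF : ∀ n : ℕ, {w : FreeMonoid β | w.length = n ∧ F w ≠ 0}.Finite) :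
    ∃ f : K[X] →ₗ[K] TensorAlgebra K V, PreservesDegree f ∧ ∀ w, wordCoef b w f = F w := by
  let a : ℕ → TensorAlgebra K V := fun n => ∑ w ∈ (hF n).toFinset, F w • b.tensorAlgebra w
  refine ⟨(Polynomial.basisMonomials K).constr K a, ?_, ?_⟩
  all_goals
    have ha : ∀ n, (Polynomial.basisMonomials K).constr K a (Polynomial.X ^ n) = a n := by
      intro n
      rw [Polynomial.X_pow_eq_monomial]
      exact Module.Basis.constr_basis (Polynomial.basisMonomials K) K a n
  · intro n
    rw [ha, range_ι_pow_eq_span b]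
    refine Submodule.sum_mem _ fun w hw => Submodule.smul_mem _ _ (Submodule.subset_span ⟨w, ?_, rfl⟩)
    exact ((hF n).mem_toFinset.1 hw).1
  · intro w
    rw [wordCoef_apply, ha, map_sum]
    classical
    simp only [map_smul, Module.Basis.coord_apply, Module.Basis.repr_self, Finsupp.single_apply,
      smul_eq_mul, mul_ite, mul_one, mul_zero, Finset.sum_ite_eq', Set.Finite.mem_toFinset]
    by_cases h : F w = 0 <;> simp [h]

theorem finite_words {f : K[X] →ₗ[K] TensorAlgebra K V} (n : ℕ) :
    {w : FreeMonoid β | w.length = n ∧ wordCoef b w f ≠ 0}.Finite := by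
  refine (b.tensorAlgebra.repr (f (Polynomial.X ^ n))).support.finite_toSet.subset ?_
  rintro w ⟨rfl, hw⟩
  exact Finsupp.mem_support_iff.2 hw

end Words

/-! ### Weighted words and weighted shifts -/

section Weights

variable {R : Type*} [CommRing R] {β : Type*}

/-- The product of the weights of the letters of a word that is written from the place `i` on. -/
def wordWeight (s : ℤ → β → R) : ℤ → List β → R
  | _, [] => 1
  | i, x :: w => s i x * wordWeight s (i + 1) w

theorem wordWeight_append (s : ℤ → β → R) (i : ℤ) (u w : List β) :
    wordWeight s i (u ++ w) = wordWeight s i u * wordWeight s (i + u.length) w := by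
  induction u generalizing i with
  | nil => simp [wordWeight]
  | cons x u ih =>
    simp only [List.cons_append, wordWeight, ih, mul_assoc, List.length_cons]
    congr 3
    push_cast
    ring

theorem wordWeight_congr {s s' : ℤ → β → R} {i : ℤ} {w : List β}
    (h : ∀ j, i ≤ j → ∀ x ∈ w, s j x = s' j x) : wordWeight s i w = wordWeight s' i w := by
  induction w generalizing i with
  | nil => rfl
  | cons x w ih =>
    rw [wordWeight, wordWeight, h i le_rfl x (by simp),
      ih fun j hj y hy => h j (by omega) y (List.mem_cons_of_mem _ hy)]

theorem map_wordWeight {R' : Type*} [CommRing R'] (η : R →+* R') (s : ℤ → β → R) (i : ℤ)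
    (w : List β) : η (wordWeight s i w) = wordWeight (fun j x => η (s j x)) i w := by
  induction w generalizing i with
  | nil => exact map_one η
  | cons x w ih => rw [wordWeight, wordWeight, map_mul, ih]

theorem wordWeight_shift (s : ℤ → β → R) (i j : ℤ) (w : List β) :
    wordWeight (fun k => s (k + j)) i w = wordWeight s (i + j) w := by
  induction w generalizing i with
  | nil => rfl
  | cons x w ih => rw [wordWeight, wordWeight, ih, add_right_comm]

open Classical in
/-- The weights that single out the word `w` written from the place `i` on. -/
noncomputable def indicatorWeight (R : Type*) [CommRing R] (i : ℤ) (w : List β) (j : ℤ) (x : β) : R :=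
  -- To the left of the place `i`, `toNat` truncates to the first letter; this region never enters a
  -- word written from `i` on.
  if w[(j - i).toNat]? = some x then 1 else 0

open Classical in
theorem wordWeight_indicator {s : ℤ → β → R} {i : ℤ} {u w : List β} (hu : u.length ≤ w.length)
    (hs : ∀ j x, i ≤ j → j < i + u.length → s j x = indicatorWeight R i w j x) :
    wordWeight s i u = if u = w.take u.length then 1 else 0 := by
  induction u generalizing i w with
  | nil => simp [wordWeight]
  | cons x u ih =>
    cases w with
    | nil => simp at hu
    | cons y w =>
      have h1 : s i x = if y = x then 1 else 0 := by
        rw [hs i x le_rfl (by simp)]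
        simp [indicatorWeight]
      have h2 : wordWeight s (i + 1) u = if u = w.take u.length then 1 else 0 := by
        refine ih (by simpa using hu) fun j z hj hj2 => ?_
        rw [hs j z (by omega) (by simp; omega), indicatorWeight, indicatorWeight]
        have : (j - i).toNat = (j - (i + 1)).toNat + 1 := by omega
        rw [this, List.getElem?_cons_succ]
      rw [wordWeight, h1, h2]
      have key : x :: u = (y :: w).take (x :: u).length ↔ y = x ∧ u = w.take u.length := by
        rw [List.length_cons, List.take_succ_cons, List.cons.injEq, eq_comm (a := x)]
      rw [if_congr key rfl rfl, ite_and]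
      split_ifs <;> simp

variable {K : Type u} [CommRing K] {V : Type v} [AddCommGroup V] [Module K V]
  (b : Module.Basis β K V) [Algebra K R]

/-- The linear extension of `wordWeight` to the tensor algebra. -/
noncomputable def weightMap (s : ℤ → β → R) (i : ℤ) : TensorAlgebra K V →ₗ[K] R :=
  b.tensorAlgebra.constr K fun w => wordWeight s i w.toList

theorem weightMap_basis (s : ℤ → β → R) (i : ℤ) (w : FreeMonoid β) :
    weightMap b s i (b.tensorAlgebra w) = wordWeight s i w.toList :=
  b.tensorAlgebra.constr_basis K _ w

theorem weightMap_apply (s : ℤ → β → R) (i : ℤ) (a : TensorAlgebra K V) :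
    weightMap b s i a =
      (b.tensorAlgebra.repr a).sum fun w c => c • wordWeight s i w.toList :=
  b.tensorAlgebra.constr_apply K _ a

theorem map_weightMap {R' : Type*} [CommRing R'] [Algebra K R'] (η : R →ₐ[K] R')
    (s : ℤ → β → R) (i : ℤ) (a : TensorAlgebra K V) :
    η (weightMap b s i a) = weightMap b (fun j x => η (s j x)) i a := by
  suffices η.toLinearMap ∘ₗ weightMap b s i = weightMap b (fun j x => η (s j x)) i from
    LinearMap.congr_fun this a
  refine b.tensorAlgebra.ext fun w => ?_
  rw [LinearMap.comp_apply, weightMap_basis, weightMap_basis]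
  exact map_wordWeight (η : R →+* R') s i w.toList

theorem weightMap_shift (s : ℤ → β → R) (i j : ℤ) (a : TensorAlgebra K V) :
    weightMap b (fun k => s (k + j)) i a = weightMap b s (i + j) a := by
  refine LinearMap.congr_fun (b.tensorAlgebra.ext fun w => ?_) a
  rw [weightMap_basis, weightMap_basis, wordWeight_shift]

/-- The operator of a letter on sequences: shift the sequence and multiply by the weights. -/
def letterOp (s : ℤ → β → R) (x : β) : Module.End R (ℕ → R) where
  toFun y i := s i x * y (i + 1)
  map_add' y z := by funext i; simp [mul_add]
  map_smul' c y := by funext i; simp [mul_left_comm]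

/-- The action of the tensor algebra on sequences by weighted shifts. -/
noncomputable def shiftRep (s : ℤ → β → R) : TensorAlgebra K V →ₐ[K] Module.End R (ℕ → R) :=
  TensorAlgebra.lift K (b.constr K (letterOp s))

theorem shiftRep_basis (s : ℤ → β → R) (w : FreeMonoid β) (y : ℕ → R) (i : ℕ) :
    shiftRep b s (b.tensorAlgebra w) y i = wordWeight s i w.toList * y (i + w.length) := by
  induction w using FreeMonoid.inductionOn' generalizing i with
  | one =>
    rw [tensorAlgebra_basis_one, map_one]
    simp [wordWeight]
  | of_mul x w ih =>
    rw [tensorAlgebra_basis_mul, map_mul, tensorAlgebra_basis_of, Module.End.mul_apply,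
      FreeMonoid.length_mul, FreeMonoid.length_of, FreeMonoid.toList_of_mul, wordWeight]
    have : shiftRep b s (TensorAlgebra.ι K (b x)) = letterOp s x := by
      rw [shiftRep, TensorAlgebra.lift_ι_apply, Module.Basis.constr_basis]
    rw [this]
    change s i x * _ = _
    rw [ih, mul_assoc, ← add_assoc]
    push_cast
    rfl

/-- All words of length `n` shift by the same amount, so a homogeneous element acts by one shift
with scalar weights, whereas inhomogeneous elements still act linearly. -/
theorem shiftRep_of_mem_pow (s : ℤ → β → R) {n : ℕ} {a : TensorAlgebra K V}
    (ha : a ∈ LinearMap.range (TensorAlgebra.ι K (M := V)) ^ n) (y : ℕ → R) (i : ℕ) :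
    shiftRep b s a y i = weightMap b s i a * y (i + n) := by
  rw [range_ι_pow_eq_span b] at ha
  induction ha using Submodule.span_induction with
  | mem a h =>
    obtain ⟨w, hw, rfl⟩ := h
    have hw' : w.length = n := hw
    rw [shiftRep_basis, weightMap_basis, hw']
  | zero => simp
  | add a c _ _ ha hc => simp [ha, hc, add_mul]
  | smul c a _ ha => simp [ha]

/-- The operators look only to the right, so they cannot move the support of a sequence beyond its
end. This keeps the number of equations finite for elements of unknown degrees. -/
theorem shiftRep_eq_zero_of_le (s : ℤ → β → R) (a : TensorAlgebra K V) {y : ℕ → R} {M : ℕ}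
    (hy : ∀ i, M ≤ i → y i = 0) {i : ℕ} (hi : M ≤ i) : shiftRep b s a y i = 0 := by
  have ha : a ∈ Submodule.span K (Set.range b.tensorAlgebra) := by
    rw [b.tensorAlgebra.span_eq]; trivial
  induction ha using Submodule.span_induction with
  | mem a h =>
    obtain ⟨w, rfl⟩ := h
    rw [shiftRep_basis, hy _ (by omega), mul_zero]
  | zero => simp
  | add a c _ _ ha hc => simp [ha, hc]
  | smul c a _ ha => simp [ha]

/-- If `f` splits with `r` terms, then each minor of size `r + 1` of the matrix of weighted values
of `f` vanishes at some place. -/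
theorem exists_det_weightMap_eq_zero [IsDomain R] (s : ℤ → β → R) {r : ℕ}
    {f : K[X] →ₗ[K] TensorAlgebra K V} {g h : Fin r → (K[X] →ₗ[K] TensorAlgebra K V)}
    (hf : PreservesDegree f) (H : PolySplit f g h) (m n : Fin (r + 1) → ℕ) :
    ∃ j : ℤ, (Matrix.of fun k l =>
      weightMap b s (j - m k) (f (Polynomial.X ^ (m k + n l)))).det = 0 := by
  obtain ⟨q, hm, hn⟩ : ∃ q, (∀ k, m k ≤ q) ∧ ∀ k, n k ≤ q :=
    ⟨∑ k, m k + ∑ k, n k,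
      fun k => (Finset.single_le_sum (fun _ _ => Nat.zero_le _) (Finset.mem_univ k)).trans
        (Nat.le_add_right _ _),
      fun k => (Finset.single_le_sum (fun _ _ => Nat.zero_le _) (Finset.mem_univ k)).trans
        (Nat.le_add_left _ _)⟩
  -- There will be `N * (r + 1)` unknowns and `r * M` equations; this is the least `N` that leaves
  -- more unknowns than equations.
  let N := 2 * q * r + 1
  let M := N + 2 * q
  -- `spread l y` is the sequence with the value `y (j, l)` at the place `q + j + n l`
  let spread : Fin (r + 1) → (Fin N × Fin (r + 1) → R) →ₗ[R] (ℕ → R) := fun l =>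
    LinearMap.pi fun e => if he : q + n l ≤ e ∧ e - (q + n l) < N then
      LinearMap.proj ((⟨e - (q + n l), he.2⟩ : Fin N), l) else 0
  have spread_apply : ∀ l y (j : Fin N), spread l y (q + j + n l) = y (j, l) := by
    intro l y j
    have h1 : q + n l ≤ q + j + n l ∧ q + j + n l - (q + n l) < N := ⟨by omega, by omega⟩
    have h2 : (⟨q + j + n l - (q + n l), h1.2⟩ : Fin N) = j := Fin.ext (by simp; omega)
    simp only [spread, LinearMap.pi_apply, dif_pos h1, LinearMap.proj_apply, h2]
  have spread_zero : ∀ l y e, M ≤ e → spread l y e = 0 := by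
    intro l y e he
    have h1 : ¬ (q + n l ≤ e ∧ e - (q + n l) < N) := by have := hn l; omega
    simp only [spread, LinearMap.pi_apply, dif_neg h1, LinearMap.zero_apply]
  -- The equations ask that ∑_l h_i(X^(n_l)) annihilates the spread sequences, for every i. Only the
  -- places below `M` have to be imposed.
  let Λ : (Fin N × Fin (r + 1) → R) →ₗ[R] (Fin r × Fin M → R) :=
    LinearMap.pi fun p => LinearMap.proj (p.2 : ℕ) ∘ₗ
      ∑ l, shiftRep b s (h p.1 (Polynomial.X ^ n l)) ∘ₗ spread l
  have hΛ : ¬ Function.Injective Λ := by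
    intro hinj
    have := card_le_of_injective R Λ hinj
    simp only [Fintype.card_prod, Fintype.card_fin] at this
    have h3 : N * (r + 1) = r * M + 1 := by simp only [M, N]; ring
    omega
  obtain ⟨y, hy, hy0⟩ : ∃ y, Λ y = 0 ∧ y ≠ 0 := by
    by_contra hcon
    push Not at hcon
    exact hΛ ((injective_iff_map_eq_zero Λ).2 hcon)
  have hker : ∀ i, ∑ l, shiftRep b s (h i (Polynomial.X ^ n l)) (spread l y) = 0 := by
    intro i
    funext e
    by_cases he : e < M
    · have := congrFun hy (i, ⟨e, he⟩)
      simpa [Λ] using this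
    · rw [Finset.sum_apply]
      exact Finset.sum_eq_zero fun l _ =>
        shiftRep_eq_zero_of_le b s _ (spread_zero l y) (not_lt.1 he)
  obtain ⟨⟨j, l₀⟩, hj⟩ := Function.ne_iff.1 hy0
  -- A place `j` where the solution is nonzero gives a nonzero kernel vector of the matrix.
  refine ⟨(q + j : ℕ), Matrix.exists_mulVec_eq_zero_iff.1 ⟨fun l => y (j, l), ?_, ?_⟩⟩
  · exact Function.ne_iff.2 ⟨l₀, hj⟩
  · funext k
    have h1 : ∑ l, shiftRep b s (f (Polynomial.X ^ (m k + n l))) (spread l y) = 0 := by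
      have h2 : ∀ l, shiftRep b s (f (Polynomial.X ^ (m k + n l))) (spread l y) =
          ∑ i, shiftRep b s (g i (Polynomial.X ^ m k))
            (shiftRep b s (h i (Polynomial.X ^ n l)) (spread l y)) := by
        intro l
        rw [pow_add, H, map_sum, LinearMap.sum_apply]
        simp only [map_mul, Module.End.mul_apply]
      simp only [h2]
      rw [Finset.sum_comm]
      refine Finset.sum_eq_zero fun i _ => ?_
      rw [← map_sum, hker, map_zero]
    -- The margin `q` keeps this place nonnegative. Reading row `k` here makes every column `l`
    -- refer to the place `q + j + n l`.
    have h3 := congrFun h1 (q + j - m k)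
    rw [Finset.sum_apply] at h3
    rw [Matrix.mulVec, dotProduct]
    refine Eq.trans (Finset.sum_congr rfl fun l _ => ?_) h3
    have hk := hm k
    rw [shiftRep_of_mem_pow b s (hf _)]
    have h4 : q + j - m k + (m k + n l) = q + j + n l := by omega
    have h5 : ((q + j - m k : ℕ) : ℤ) = ((q + j : ℕ) : ℤ) - m k := by push_cast [hk]; omega
    rw [h4, spread_apply, h5, Matrix.of_apply]

end Weights

/-! ### Rank factorization over a domain -/

/-- A matrix over a domain without nonzero minors of size `r + 1` is determined by finitely many of
its rows and columns. -/
theorem exists_det_mul_eq_sum {R : Type*} [CommRing R] [IsDomain R] (α : ℕ → ℕ → R) (r : ℕ)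
    (h : ∀ m n : Fin (r + 1) → ℕ, (Matrix.of fun k l => α (m k) (n l)).det = 0) :
    ∃ (p : ℕ) (ms ns : Fin p → ℕ), (Matrix.of fun k l => α (ms k) (ns l)).det ≠ 0 ∧
      ∀ m n, (Matrix.of fun k l => α (ms k) (ns l)).det * α m n =
        ∑ j, (∑ l, α m (ns l) * (Matrix.of fun k l => α (ms k) (ns l)).adjugate l j) *
          α (ms j) n := by
  -- The size `p` is one at which a nonzero minor exists while all minors of size `p + 1` vanish;
  -- the empty minor starts the search.
  obtain ⟨p, ⟨ms, ns, hp⟩, hp1⟩ : ∃ p,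
      (∃ ms ns : Fin p → ℕ, (Matrix.of fun k l => α (ms k) (ns l)).det ≠ 0) ∧
      ¬ ∃ ms ns : Fin (p + 1) → ℕ, (Matrix.of fun k l => α (ms k) (ns l)).det ≠ 0 := by
    by_contra hcon
    push Not at hcon
    have : ∀ p, ∃ ms ns : Fin p → ℕ, (Matrix.of fun k l => α (ms k) (ns l)).det ≠ 0 := by
      intro p
      induction p with
      | zero => exact ⟨Fin.elim0, Fin.elim0, by simp⟩
      | succ p ih => obtain ⟨ms, ns, h⟩ := ih; exact hcon p ⟨ms, ns, h⟩
    obtain ⟨ms, ns, h'⟩ := this (r + 1)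
    exact h' (h ms ns)
  refine ⟨p, ms, ns, hp, fun m n => ?_⟩
  set A : Matrix (Fin p) (Fin p) R := Matrix.of fun k l => α (ms k) (ns l) with hA
  push Not at hp1
  -- The minor bordered by row `m` and column `n` is singular; its left kernel vector expresses row
  -- `m` through the chosen rows.
  obtain ⟨v, hv, hvM⟩ := Matrix.exists_vecMul_eq_zero_iff.2
    (hp1 (Fin.snoc ms m) (Fin.snoc ns n))
  let x : Fin p → R := fun k => v k.castSucc
  let z : R := v (Fin.last p)
  have e1 : Matrix.vecMul x A = - z • fun l => α m (ns l) := by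
    funext l
    have := congrFun hvM l.castSucc
    simp only [Matrix.vecMul, dotProduct, Fin.sum_univ_castSucc, Matrix.of_apply,
      Fin.snoc_castSucc, Fin.snoc_last, Pi.zero_apply] at this
    simpa [Matrix.vecMul, dotProduct, A, x, z] using eq_neg_of_add_eq_zero_left this
  have e2 : ∑ k, x k * α (ms k) n = - (z * α m n) := by
    have := congrFun hvM (Fin.last p)
    simp only [Matrix.vecMul, dotProduct, Fin.sum_univ_castSucc, Matrix.of_apply,
      Fin.snoc_castSucc, Fin.snoc_last, Pi.zero_apply] at this
    exact eq_neg_of_add_eq_zero_left this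
  have e3 : ∀ j, A.det * x j = - z * ∑ l, α m (ns l) * A.adjugate l j := by
    intro j
    have := congrFun (congrArg (fun y => Matrix.vecMul y A.adjugate) e1) j
    simp only [Matrix.vecMul_vecMul, Matrix.mul_adjugate, Matrix.vecMul_smul, Matrix.vecMul_one,
      Matrix.smul_vecMul, Pi.smul_apply, smul_eq_mul] at this
    rw [this]
    rfl
  -- If the coefficient of the new row were zero, the invertibility of `A` over the fraction field
  -- would kill the whole vector.
  have hz : z ≠ 0 := by
    intro hz
    refine hv (funext fun k => ?_)
    refine Fin.lastCases hz (fun k => ?_) k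
    have := e3 k
    rw [hz, neg_zero, zero_mul] at this
    exact (mul_eq_zero.1 this).resolve_left hp
  refine mul_left_cancel₀ hz ?_
  calc z * (A.det * α m n) = - (A.det * ∑ k, x k * α (ms k) n) := by rw [e2]; ring
    _ = _ := by
      rw [Finset.mul_sum, Finset.mul_sum, ← Finset.sum_neg_distrib]
      refine Finset.sum_congr rfl fun j _ => ?_
      rw [← mul_assoc, e3]
      ring

/-! ### Generic weights: finite rank and finitely many letters -/

section Rationality

variable {β : Type*}

theorem wordWeight_eq_zero {R : Type*} [CommRing R] {s : ℤ → β → R} {x : β}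
    (hs : ∀ j, s j x = 0) {w : List β} (hx : x ∈ w) (i : ℤ) : wordWeight s i w = 0 := by
  induction w generalizing i with
  | nil => simp at hx
  | cons y w ih =>
    rw [wordWeight]
    rcases List.mem_cons.1 hx with rfl | h
    · rw [hs, zero_mul]
    · rw [ih h, mul_zero]

theorem finite_words_over (B : Finset β) (n : ℕ) :
    {w : FreeMonoid β | w.length = n ∧ ∀ x ∈ w.toList, x ∈ B}.Finite := by
  induction n with
  | zero =>
    refine (Set.finite_singleton (1 : FreeMonoid β)).subset ?_
    rintro w ⟨hw, -⟩
    exact FreeMonoid.length_eq_zero.1 hw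
  | succ n ih =>
    refine (Set.Finite.image2 (fun x (w : FreeMonoid β) => FreeMonoid.of x * w)
      B.finite_toSet ih).subset ?_
    rintro w ⟨hw, hB⟩
    induction w using FreeMonoid.casesOn with
    | one => simp at hw
    | of_mul y w =>
      rw [FreeMonoid.length_mul, FreeMonoid.length_of] at hw
      exact ⟨y, hB y (by simp), w, ⟨by omega, fun x hx => hB x (by simp [hx])⟩, rfl⟩

variable {K : Type u} {V : Type v} [AddCommGroup V]

section CommRing

variable [CommRing K] [Module K V] (b : Module.Basis β K V)

theorem weightMap_congr {R : Type*} [CommRing R] [Algebra K R] {s s' : ℤ → β → R} {i : ℤ}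
    {a : TensorAlgebra K V}
    (h : ∀ w, b.tensorAlgebra.coord w a ≠ 0 → wordWeight s i w.toList = wordWeight s' i w.toList) :
    weightMap b s i a = weightMap b s' i a := by
  rw [weightMap_apply, weightMap_apply]
  exact Finsupp.sum_congr fun w hw => by rw [h w (Finsupp.mem_support_iff.1 hw)]

theorem weightMap_indicator {s : ℤ → β → K} {i : ℤ} {w : FreeMonoid β} {a : TensorAlgebra K V}
    (ha : a ∈ LinearMap.range (TensorAlgebra.ι K (M := V)) ^ w.length)
    (hs : ∀ j x, i ≤ j → j < i + w.length → s j x = indicatorWeight K i w.toList j x) :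
    weightMap b s i a = b.tensorAlgebra.coord w a := by
  classical
  rw [weightMap_apply, Finsupp.sum, Finset.sum_eq_single w]
  · rw [wordWeight_indicator le_rfl hs]
    simp
  · intro w' hw' hne
    have hl : w'.length = w.length := by
      by_contra hcon
      exact Finsupp.mem_support_iff.1 hw' (coord_eq_zero_of_mem_pow b ha hcon)
    have hl' : w'.toList.length = w.toList.length := hl
    have hs' : ∀ j x, i ≤ j → j < i + w'.toList.length →
        s j x = indicatorWeight K i w.toList j x := by
      rw [hl']; exact hs
    rw [wordWeight_indicator hl'.le hs', hl', List.take_length, if_neg, smul_zero]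
    exact fun h => hne h
  · intro hw
    rw [Finsupp.notMem_support_iff.1 hw, zero_smul]

end CommRing

variable [Field K] [Module K V] (b : Module.Basis β K V)

/-- The generic weights. -/
noncomputable def genericWeight (K : Type u) [Field K] (β : Type*) (j : ℤ) (x : β) :
    MvPolynomial (ℤ × β) K :=
  MvPolynomial.X (j, x)

/-- The place at which the minor vanishes depends on `m` and `n`, but for generic weights a change
of place is an injective renaming of variables, so the minor vanishes at the place 0 as well. -/
theorem det_weightMap_generic_eq_zero {r : ℕ}
    {f : K[X] →ₗ[K] TensorAlgebra K V} {g h : Fin r → (K[X] →ₗ[K] TensorAlgebra K V)}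
    (hf : PreservesDegree f) (H : PolySplit f g h) (m n : Fin (r + 1) → ℕ) :
    (Matrix.of fun k l =>
      weightMap b (genericWeight K β) (-m k) (f (Polynomial.X ^ (m k + n l)))).det = 0 := by
  obtain ⟨j, hj⟩ := exists_det_weightMap_eq_zero b (genericWeight K β) hf H m n
  let η : MvPolynomial (ℤ × β) K →ₐ[K] MvPolynomial (ℤ × β) K :=
    MvPolynomial.rename fun p => (p.1 + j, p.2)
  have hη : Function.Injective η := by
    refine MvPolynomial.rename_injective _ fun p p' h => ?_
    simp only [Prod.mk.injEq, add_left_inj] at h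
    exact Prod.ext h.1 h.2
  refine hη ?_
  rw [map_zero, AlgHom.map_det, ← hj]
  congr 1
  ext1 k l
  simp only [AlgHom.mapMatrix_apply, Matrix.map_apply, Matrix.of_apply]
  rw [map_weightMap, sub_eq_neg_add, ← weightMap_shift b (genericWeight K β)]
  congr 2
  funext i x
  exact MvPolynomial.rename_X _ _

/-- The weighted value of `f` with `m` letters before the place `0` and `n` letters after it. -/
noncomputable def hankelEntry {R : Type*} [CommRing R] [Algebra K R]
    (f : K[X] →ₗ[K] TensorAlgebra K V) (s : ℤ → β → R) (m n : ℕ) : R :=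
  weightMap b s (-m) (f (Polynomial.X ^ (m + n)))

/-- The generic values of `f` are determined by finitely many rows and columns, also after a
substitution that fixes these rows. -/
theorem exists_hankelEntry_eq {f : K[X] →ₗ[K] TensorAlgebra K V} (hf : f ∈ BLRep K V) :
    ∃ (q p : ℕ) (ms ns : Fin p → ℕ) (Δ : MvPolynomial (ℤ × β) K)
      (D : Fin p → Fin p → MvPolynomial (ℤ × β) K),
      (∀ k, ms k < q) ∧ (∀ k, ns k < q) ∧ Δ ≠ 0 ∧
      ∀ s : ℤ → β → MvPolynomial (ℤ × β) K,
        (∀ k l, hankelEntry b f s (ms k) (ns l) =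
          hankelEntry b f (genericWeight K β) (ms k) (ns l)) →
        ∀ m n, Δ * hankelEntry b f s m n =
          ∑ j, (∑ l, hankelEntry b f s m (ns l) * D l j) * hankelEntry b f s (ms j) n := by
  obtain ⟨hf, r, g, h, H⟩ := hf
  obtain ⟨p, ms, ns, hdet, hid⟩ := exists_det_mul_eq_sum
    (hankelEntry b f (genericWeight K β)) r (det_weightMap_generic_eq_zero b hf H)
  refine ⟨∑ k, ms k + ∑ k, ns k + 1, p, ms, ns, _,
      (Matrix.of fun k l => hankelEntry b f (genericWeight K β) (ms k) (ns l)).adjugate,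
      fun k => Nat.lt_succ_of_le <| (Finset.single_le_sum (fun _ _ => Nat.zero_le _)
        (Finset.mem_univ k)).trans (Nat.le_add_right _ _),
      fun k => Nat.lt_succ_of_le <| (Finset.single_le_sum (fun _ _ => Nat.zero_le _)
        (Finset.mem_univ k)).trans (Nat.le_add_left _ _), hdet, fun s hs m n => ?_⟩
  -- Substituting the weights into the generic identity fixes its determinant and adjugate, because
  -- it fixes the entries of the chosen minor. So the leading coefficient stays nonzero.
  let η : MvPolynomial (ℤ × β) K →ₐ[K] MvPolynomial (ℤ × β) K :=
    MvPolynomial.aeval fun p => s p.1 p.2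
  have hη : ∀ m n, η (hankelEntry b f (genericWeight K β) m n) = hankelEntry b f s m n := by
    intro m n
    rw [hankelEntry, map_weightMap, hankelEntry]
    congr 2
    funext j x
    exact MvPolynomial.aeval_X _ _
  have hA : η.mapMatrix
      (Matrix.of fun k l => hankelEntry b f (genericWeight K β) (ms k) (ns l)) =
      Matrix.of fun k l => hankelEntry b f (genericWeight K β) (ms k) (ns l) := by
    ext1 k l
    simp only [AlgHom.mapMatrix_apply, Matrix.map_apply, Matrix.of_apply, hη, hs]
  have h1 := congrArg η (hid m n)
  simp only [map_mul, map_sum, hη] at h1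
  rw [AlgHom.map_det, hA] at h1
  rw [h1]
  refine Finset.sum_congr rfl fun j _ => ?_
  congr 1
  refine Finset.sum_congr rfl fun l _ => ?_
  congr 1
  have h2 := AlgHom.map_adjugate η
    (Matrix.of fun k l => hankelEntry b f (genericWeight K β) (ms k) (ns l))
  rw [hA] at h2
  exact congrFun (congrFun h2 l) j

theorem hankelEntry_indicator {f : K[X] →ₗ[K] TensorAlgebra K V} (hf : PreservesDegree f)
    {s : ℤ → β → K} {m n : ℕ} {w : FreeMonoid β} (hw : w.length = m + n)
    (hs : ∀ (j : ℤ) x, -m ≤ j → s j x = indicatorWeight K (-m) w.toList j x) :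
    hankelEntry b f s m n = wordCoef b w f := by
  rw [hankelEntry, ← hw, wordCoef_apply]
  exact weightMap_indicator b (hf _) fun j x hj _ => hs j x hj

theorem map_hankelEntry {R R' : Type*} [CommRing R] [CommRing R'] [Algebra K R] [Algebra K R']
    (η : R →ₐ[K] R') (f : K[X] →ₗ[K] TensorAlgebra K V) (s : ℤ → β → R) (m n : ℕ) :
    η (hankelEntry b f s m n) = hankelEntry b f (fun j x => η (s j x)) m n :=
  map_weightMap b η s _ _

theorem hankelEntry_congr {R : Type*} [CommRing R] [Algebra K R]
    {f : K[X] →ₗ[K] TensorAlgebra K V} (hf : PreservesDegree f) {s s' : ℤ → β → R} {m n : ℕ}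
    (h : ∀ w : FreeMonoid β, w.length = m + n → wordCoef b w f ≠ 0 →
      wordWeight s (-m) w.toList = wordWeight s' (-m) w.toList) :
    hankelEntry b f s m n = hankelEntry b f s' m n := by
  refine weightMap_congr b fun w hw => ?_
  have hl : w.length = m + n := by
    by_contra hcon
    exact hw (coord_eq_zero_of_mem_pow b (hf _) hcon)
  refine h w hl ?_
  rwa [wordCoef_apply, hl]

/-- Only finitely many letters occur in a representative map. -/
theorem exists_finite_letters {f : K[X] →ₗ[K] TensorAlgebra K V} (hf : f ∈ BLRep K V) :
    ∃ B : Finset β, ∀ w : FreeMonoid β, wordCoef b w f ≠ 0 → ∀ x ∈ w.toList, x ∈ B := by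
  classical
  obtain ⟨q, p, ms, ns, Δ, D, hms, hns, hΔ, hid⟩ := exists_hankelEntry_eq b hf
  have hd : PreservesDegree f := hf.1
  -- The letters of all words of length at most `2 * q` suffice: longer words are governed by the
  -- rank identity.
  let B : Finset β := (Finset.range (2 * q + 1)).biUnion fun N =>
    (finite_words b (f := f) N).toFinset.biUnion fun w => w.toList.toFinset
  refine ⟨B, ?_⟩
  suffices ∀ N, ∀ w : FreeMonoid β, w.length = N → wordCoef b w f ≠ 0 → ∀ x ∈ w.toList, x ∈ B from
    fun w => this _ w rfl
  intro N
  induction N using Nat.strong_induction_on with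
  | _ N ih =>
    intro w hw hne x hx
    by_cases hN : N ≤ 2 * q
    · simp only [B, Finset.mem_biUnion, Finset.mem_range, Set.Finite.mem_toFinset, List.mem_toFinset]
      exact ⟨N, by omega, w, ⟨hw, hne⟩, hx⟩
    by_contra hxB
    -- Killing the letters outside `B` does not change the entries belonging to words shorter than
    -- `N`, by induction.
    let s : ℤ → β → MvPolynomial (ℤ × β) K := fun j x => if x ∈ B then genericWeight K β j x else 0
    have hs : ∀ m n, m + n < N →
        hankelEntry b f s m n = hankelEntry b f (genericWeight K β) m n := by
      intro m n hmn
      refine hankelEntry_congr b hd fun w hw hne => wordWeight_congr fun j _ y hy => ?_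
      exact if_pos (ih _ hmn w hw hne y hy)
    have hfix : ∀ k l, hankelEntry b f s (ms k) (ns l) =
        hankelEntry b f (genericWeight K β) (ms k) (ns l) :=
      fun k l => hs _ _ (by have := hms k; have := hns l; omega)
    -- With the cut `q + (N - q)`, every entry on the right of the identity belongs to a word of
    -- length less than `N`, so the entry on the left is unchanged too.
    have h1 := hid s hfix q (N - q)
    have h2 := hid (genericWeight K β) (fun _ _ => rfl) q (N - q)
    have h3 : hankelEntry b f s q (N - q) =
        hankelEntry b f (genericWeight K β) q (N - q) := by
      refine mul_left_cancel₀ hΔ ?_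
      rw [h1, h2]
      refine Finset.sum_congr rfl fun j _ => ?_
      have := hms j
      rw [hs (ms j) (N - q) (by omega)]
      congr 1
      refine Finset.sum_congr rfl fun l _ => ?_
      have := hns l
      rw [hs q (ns l) (by omega)]
    let e : MvPolynomial (ℤ × β) K →ₐ[K] K :=
      MvPolynomial.aeval fun p => indicatorWeight K (-q) w.toList p.1 p.2
    have he : ∀ j y, e (genericWeight K β j y) = indicatorWeight K (-q) w.toList j y :=
      fun j y => MvPolynomial.aeval_X _ _
    have hl : w.length = q + (N - q) := by omega
    have h4 : e (hankelEntry b f (genericWeight K β) q (N - q)) = wordCoef b w f := by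
      rw [map_hankelEntry]
      exact hankelEntry_indicator b hd hl fun j y _ => he j y
    have h5 : e (hankelEntry b f s q (N - q)) = 0 := by
      rw [map_hankelEntry]
      have : hankelEntry b f (fun j x => e (s j x)) q (N - q) =
          hankelEntry b f (fun _ _ => (0 : K)) q (N - q) := by
        refine hankelEntry_congr b hd fun w' hw' _ => ?_
        have hpos : ∃ y, y ∈ w'.toList := by
          have : w'.toList.length = q + (N - q) := hw'
          exact List.exists_mem_of_length_pos (by omega)
        obtain ⟨y₀, hy₀⟩ := hpos
        rw [wordWeight_eq_zero (s := fun _ _ => (0 : K)) (fun _ => rfl) hy₀]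
        -- A word over `B` differs from `w`, which contains `x`, so the indicator kills it; any
        -- other word is killed by a zero weight.
        by_cases hB : ∀ y ∈ w'.toList, y ∈ B
        · have hw'' : w'.toList.length = w.toList.length := hw'.trans hl.symm
          rw [wordWeight_congr (s' := indicatorWeight K (-q) w.toList) fun j _ y hy => ?_,
            wordWeight_indicator hw''.le (fun _ _ _ _ => rfl), if_neg]
          · rw [hw'', List.take_length]
            intro h
            exact hxB (hB x (h ▸ hx))
          · simp only [s, if_pos (hB y hy), he]
        · push Not at hB
          obtain ⟨y, hy, hyB⟩ := hB
          exact wordWeight_eq_zero (fun j => by simp only [s, if_neg hyB, map_zero]) hy _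
      rw [this, hankelEntry, weightMap_apply]
      refine Finset.sum_eq_zero fun w' hw' => ?_
      have hl' : w'.length = q + (N - q) := by
        by_contra hcon
        exact Finsupp.mem_support_iff.1 hw' (coord_eq_zero_of_mem_pow b (hd _) hcon)
      have : w'.toList.length = q + (N - q) := hl'
      obtain ⟨y, hy⟩ := List.exists_mem_of_length_pos (l := w'.toList) (by omega)
      dsimp only
      rw [wordWeight_eq_zero (s := fun _ _ => (0 : K)) (fun _ => rfl) hy, smul_zero]
    exact hne (by rw [← h4, ← h3, h5])

end Rationality

/-! ### Finite-dimensionality of the translates, and splitting within BL(V) -/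

section Translates

variable {β : Type*} {K : Type u} {V : Type v} [AddCommGroup V] [Field K] [Module K V]
  (b : Module.Basis β K V)

/-- The span of the left translates of the word function of `f`. -/
noncomputable def leftTranslates (f : K[X] →ₗ[K] TensorAlgebra K V) :
    Submodule K (FreeMonoid β → K) :=
  Submodule.span K (Set.range fun (u : FreeMonoid β) w => wordCoef b (u * w) f)

/-- The indicator weights to the left of `-q` keep exactly the words with prefix `u`, and the
remainder contributes its generic monomial. The resulting span is independent of `u`. -/
theorem hankelEntry_mem_span {f : K[X] →ₗ[K] TensorAlgebra K V} (hf : PreservesDegree f)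
    {B : Finset β} (hB : ∀ w : FreeMonoid β, wordCoef b w f ≠ 0 → ∀ x ∈ w.toList, x ∈ B)
    {s : ℤ → β → MvPolynomial (ℤ × β) K} {q : ℕ} {u : FreeMonoid β}
    (hs : ∀ (j : ℤ) x, -q ≤ j → s j x = genericWeight K β j x)
    (hs' : ∀ (j : ℤ) x, j < -q →
      s j x = indicatorWeight (MvPolynomial (ℤ × β) K) (-(u.length + q : ℕ)) u.toList j x)
    (n : ℕ) :
    hankelEntry b f s (u.length + q) n ∈ Submodule.span K
      ((fun v : FreeMonoid β => wordWeight (genericWeight K β) (-q) v.toList) ''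
        {v | v.length = q + n ∧ ∀ x ∈ v.toList, x ∈ B}) := by
  classical
  rw [hankelEntry, weightMap_apply]
  refine Submodule.sum_mem _ fun w hw => Submodule.smul_mem _ _ ?_
  have hl : w.length = u.length + q + n := by
    by_contra hcon
    exact Finsupp.mem_support_iff.1 hw (coord_eq_zero_of_mem_pow b (hf _) hcon)
  have hne : wordCoef b w f ≠ 0 := by
    rw [wordCoef_apply, hl]
    exact Finsupp.mem_support_iff.1 hw
  have hlen : w.toList.length = u.toList.length + q + n := hl
  have hul : u.length = u.toList.length := rfl
  rw [← List.take_append_drop u.length w.toList, wordWeight_append]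
  have ht : (w.toList.take u.length).length = u.length := by simp [hlen, hul]; omega
  have h1 : wordWeight s (-(u.length + q : ℕ)) (w.toList.take u.length) =
      if w.toList.take u.length = u.toList then 1 else 0 := by
    rw [wordWeight_indicator (w := u.toList) ht.le, ht]
    · rw [hul, List.take_length]
    · intro j x _ hj
      refine hs' j x ?_
      rw [ht] at hj
      push_cast at hj
      omega
  rw [h1]
  split_ifs
  · rw [one_mul, ht]
    refine Submodule.subset_span ⟨FreeMonoid.ofList (w.toList.drop u.length), ⟨?_, ?_⟩, ?_⟩
    · change (w.toList.drop u.length).length = _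
      simp [hlen, hul]; omega
    · exact fun x hx => hB w hne x (List.mem_of_mem_drop hx)
    · have : (-((u.length + q : ℕ) : ℤ) + u.length) = -q := by push_cast; ring
      rw [this]
      exact wordWeight_congr fun j hj x _ => (hs j x hj).symm
  · rw [zero_mul]
    exact Submodule.zero_mem _

/-- The word function of a representative map has a finite-dimensional space of translates. -/
theorem finiteDimensional_leftTranslates {f : K[X] →ₗ[K] TensorAlgebra K V}
    (hf : f ∈ BLRep K V) : FiniteDimensional K (leftTranslates b f) := by
  classical
  obtain ⟨B, hB⟩ := exists_finite_letters b hf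
  obtain ⟨q, p, ms, ns, Δ, D, hms, hns, hΔ, hid⟩ := exists_hankelEntry_eq b hf
  have hd : PreservesDegree f := hf.1
  let R := MvPolynomial (ℤ × β) K
  -- Only weights left of `-q` are specialized, so the rows `ms k`, and with them Δ, are untouched.
  -- What remains of `f` is a generating function of v ↦ F(uv) over words v of length at least `q`.
  let s : FreeMonoid β → ℤ → β → R := fun u j x => if -(q : ℤ) ≤ j then genericWeight K β j x else
    indicatorWeight R (-(u.length + q : ℕ)) u.toList j x
  have hfix : ∀ u k n, k ≤ q → hankelEntry b f (s u) k n =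
      hankelEntry b f (genericWeight K β) k n := by
    intro u k n hk
    exact hankelEntry_congr b hd fun w _ _ => wordWeight_congr fun j hj x _ =>
      if_pos (by omega)
  let Γ : FreeMonoid β → ℕ → R := fun u n => hankelEntry b f (s u) (u.length + q) n
  let Z : Submodule K R := ⨆ l : Fin p, Submodule.span K
      ((fun v : FreeMonoid β => wordWeight (genericWeight K β) (-q) v.toList) ''
        {v | v.length = q + ns l ∧ ∀ x ∈ v.toList, x ∈ B})
  have : FiniteDimensional K Z := by
    have : ∀ l : Fin p, FiniteDimensional K (Submodule.span K
      ((fun v : FreeMonoid β => wordWeight (genericWeight K β) (-q) v.toList) ''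
        {v | v.length = q + ns l ∧ ∀ x ∈ v.toList, x ∈ B})) := fun l =>
      FiniteDimensional.span_of_finite K ((finite_words_over B _).image _)
    exact Submodule.finiteDimensional_iSup _
  have hZ : ∀ u l, Γ u (ns l) ∈ Z := fun u l =>
    Submodule.mem_iSup_of_mem l (hankelEntry_mem_span b hd hB (fun j x hj => if_pos hj)
      (fun j x hj => if_neg (not_le.2 hj)) _)
  let T : Fin p → Fin p → R →ₗ[K] (ℕ → R) := fun l j =>
    LinearMap.pi fun n => LinearMap.mulRight K (D l j * hankelEntry b f (genericWeight K β) (ms j) n)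
  let Ω' : Submodule K (ℕ → R) := ⨆ l, ⨆ j, Z.map (T l j)
  let mulΔ : (ℕ → R) →ₗ[K] (ℕ → R) := LinearMap.pi fun n => LinearMap.mulLeft K Δ ∘ₗ LinearMap.proj n
  have hmulΔ : Function.Injective mulΔ := by
    intro y z hyz
    funext n
    exact mul_left_cancel₀ hΔ (congrFun hyz n)
  -- The identity places Δ times each `Γ u` in `Ω'`, which does not depend on `u`. Division by Δ
  -- costs nothing, since multiplication by Δ is injective.
  let Ω : Submodule K (ℕ → R) := Ω'.comap mulΔ
  have hΩ : FiniteDimensional K Ω := by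
    have : FiniteDimensional K Ω' := inferInstance
    refine Module.Finite.of_injective (mulΔ.restrict (p := Ω) (q := Ω') fun y hy => hy) ?_
    intro y z hyz
    exact Subtype.ext (hmulΔ (congrArg Subtype.val hyz))
  have hΓ : ∀ u, Γ u ∈ Ω := by
    intro u
    have : mulΔ (Γ u) = ∑ l, ∑ j, T l j (Γ u (ns l)) := by
      funext n
      have := hid (s u) (fun k l => hfix u _ _ (hms k).le) (u.length + q) n
      refine this.trans ?_
      simp only [Finset.sum_apply]
      rw [Finset.sum_comm]
      refine Finset.sum_congr rfl fun j _ => ?_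
      rw [Finset.sum_mul, hfix u _ _ (hms j).le]
      exact Finset.sum_congr rfl fun l _ => mul_assoc _ _ _
    change mulΔ (Γ u) ∈ Ω'
    rw [this]
    refine Submodule.sum_mem _ fun l _ => Submodule.sum_mem _ fun j _ => ?_
    exact Submodule.mem_iSup_of_mem l (Submodule.mem_iSup_of_mem j
      (Submodule.mem_map_of_mem (hZ u l)))
  -- Specializing the remaining generic weights to the word `v * w` recovers the coefficient of `f`
  -- at `u * v * w`.
  let π : FreeMonoid β → (ℕ → R) →ₗ[K] (FreeMonoid β → K) := fun v => LinearMap.pi fun w =>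
    (MvPolynomial.aeval (fun p : ℤ × β =>
      indicatorWeight K (-q) (v * w).toList p.1 p.2)).toLinearMap ∘ₗ LinearMap.proj w.length
  have hπ : ∀ u v : FreeMonoid β, v.length = q →
      π v (Γ u) = fun w => wordCoef b (u * v * w) f := by
    intro u v hv
    funext w
    change MvPolynomial.aeval _ (hankelEntry b f (s u) (u.length + q) w.length) = _
    rw [map_hankelEntry]
    refine hankelEntry_indicator b hd (by simp [hv]) fun j x hj => ?_
    by_cases hjq : -(q : ℤ) ≤ j
    · simp only [s, if_pos hjq, genericWeight, MvPolynomial.aeval_X]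
      have hul : u.length = u.toList.length := rfl
      rw [indicatorWeight, indicatorWeight, mul_assoc, FreeMonoid.toList_mul u,
        List.getElem?_append_right (by push_cast; omega)]
      congr 4
      push_cast
      omega
    · simp only [s, if_neg hjq]
      have hul : u.length = u.toList.length := rfl
      rw [indicatorWeight, indicatorWeight, mul_assoc, FreeMonoid.toList_mul u,
        List.getElem?_append_left (by push_cast at hj ⊢; omega)]
      split_ifs <;> simp
  have hzero : ∀ u : FreeMonoid β, (∃ x ∈ u.toList, x ∉ B) →
      (fun w => wordCoef b (u * w) f) = 0 := by
    rintro u ⟨x, hx, hxB⟩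
    funext w
    by_contra hne
    exact hxB (hB _ hne x (by simp [hx]))
  -- A word of length at least `q` is cut before its last `q` letters and treated by `S₁`; the
  -- finitely many shorter words over `B` go into `S₂`.
  let S₁ : Submodule K (FreeMonoid β → K) := ⨆ v : (finite_words_over B q).toFinset, Ω.map (π v)
  let S₂ : Submodule K (FreeMonoid β → K) := ⨆ n : Fin q, Submodule.span K
    ((fun (u : FreeMonoid β) w => wordCoef b (u * w) f) ''
      {u | u.length = n ∧ ∀ x ∈ u.toList, x ∈ B})
  have : FiniteDimensional K S₂ := by
    have : ∀ n : Fin q, FiniteDimensional K (Submodule.span K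
      ((fun (u : FreeMonoid β) w => wordCoef b (u * w) f) ''
      {u | u.length = n ∧ ∀ x ∈ u.toList, x ∈ B})) := fun n =>
      FiniteDimensional.span_of_finite K ((finite_words_over B _).image _)
    exact Submodule.finiteDimensional_iSup _
  have : FiniteDimensional K S₁ := Submodule.finiteDimensional_iSup _
  refine Submodule.finiteDimensional_of_le (S₂ := S₁ ⊔ S₂) (Submodule.span_le.2 ?_)
  rintro _ ⟨u, rfl⟩
  by_cases hu : ∀ x ∈ u.toList, x ∈ B
  swap
  · push Not at hu
    dsimp only
    rw [hzero u hu]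
    exact Submodule.zero_mem _
  by_cases hq : u.length < q
  · exact Submodule.mem_sup_right (Submodule.mem_iSup_of_mem ⟨u.length, hq⟩
      (Submodule.subset_span ⟨u, ⟨rfl, hu⟩, rfl⟩))
  · refine Submodule.mem_sup_left ?_
    have hul : u.length = u.toList.length := rfl
    let u₁ : FreeMonoid β := FreeMonoid.ofList (u.toList.take (u.length - q))
    let u₂ : FreeMonoid β := FreeMonoid.ofList (u.toList.drop (u.length - q))
    have h12 : u = u₁ * u₂ := (List.take_append_drop _ _).symm
    have h2 : u₂.length = q := by
      change (u.toList.drop (u.length - q)).length = q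
      rw [List.length_drop]; omega
    have h3 : u₂ ∈ (finite_words_over B q).toFinset := by
      rw [Set.Finite.mem_toFinset]
      exact ⟨h2, fun x hx => hu x (List.mem_of_mem_drop hx)⟩
    refine Submodule.mem_iSup_of_mem ⟨u₂, h3⟩ ⟨Γ u₁, hΓ u₁, ?_⟩
    rw [hπ u₁ u₂ h2, ← h12]

/-- Translation of a function on words. -/
def wordTranslate (K : Type u) [Field K] (u : FreeMonoid β) :
    (FreeMonoid β → K) →ₗ[K] (FreeMonoid β → K) where
  toFun F w := F (u * w)
  map_add' _ _ := rfl
  map_smul' _ _ := rfl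

theorem wordTranslate_mem_leftTranslates (f : K[X] →ₗ[K] TensorAlgebra K V) (u : FreeMonoid β)
    {F : FreeMonoid β → K} (hF : F ∈ leftTranslates b f) :
    wordTranslate K u F ∈ leftTranslates b f := by
  induction hF using Submodule.span_induction with
  | mem F h =>
    obtain ⟨v, rfl⟩ := h
    refine Submodule.subset_span ⟨v * u, ?_⟩
    funext w
    simp [wordTranslate, mul_assoc]
  | zero => rw [map_zero]; exact Submodule.zero_mem _
  | add F G _ _ hF hG => rw [map_add]; exact Submodule.add_mem _ hF hG
  | smul c F _ hF => rw [map_smul]; exact Submodule.smul_mem _ c hF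

/-- A representative map splits into representative maps. -/
theorem exists_polySplit_BLRep {β : Type*} (b : Module.Basis β K V) (f : BLRep K V) : ∃ (n : ℕ) (g h : Fin n → BLRep K V),
    PolySplit f.1 (fun i => (g i).1) (fun i => (h i).1) := by
  obtain ⟨f, hf⟩ := f
  obtain ⟨B, hB⟩ := exists_finite_letters b hf
  have hfin := finiteDimensional_leftTranslates b hf
  have hd : PreservesDegree f := hf.1
  let S := leftTranslates b f
  let F : S := ⟨fun w => wordCoef b w f, Submodule.subset_span ⟨1, by simp⟩⟩
  let τ : FreeMonoid β → S →ₗ[K] S := fun u =>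
    (wordTranslate K u).restrict fun _ h => wordTranslate_mem_leftTranslates b f u h
  have hττ : ∀ u v x, τ (u * v) x = τ v (τ u x) := fun u v x => Subtype.ext (funext fun w =>
    congrArg x.1 (mul_assoc u v w))
  have hS0 : ∀ x : S, ∀ u : FreeMonoid β, (∃ y ∈ u.toList, y ∉ B) → x.1 u = 0 := by
    rintro ⟨x, hx⟩ u ⟨y, hy, hyB⟩
    change x u = 0
    induction hx using Submodule.span_induction with
    | mem x h =>
      obtain ⟨v, rfl⟩ := h
      by_contra hne
      exact hyB (hB _ hne y (by simp [hy]))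
    | zero => rfl
    | add x z _ _ hx hz => rw [Pi.add_apply, hx, hz, add_zero]
    | smul c x _ hx => rw [Pi.smul_apply, hx, smul_zero]
  have hτ0 : ∀ u : FreeMonoid β, (∃ y ∈ u.toList, y ∉ B) → ∀ x, τ u x = 0 := by
    rintro u ⟨y, hy, hyB⟩ x
    exact Subtype.ext (funext fun w => hS0 x (u * w) ⟨y, by simp [hy], hyB⟩)
  have hfinite : ∀ F : FreeMonoid β → K, (∀ u : FreeMonoid β, (∃ y ∈ u.toList, y ∉ B) → F u = 0) →
      ∀ n : ℕ, {w : FreeMonoid β | w.length = n ∧ F w ≠ 0}.Finite := by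
    intro F hF n
    refine (finite_words_over B n).subset fun w hw => ⟨hw.1, fun x hx => ?_⟩
    by_contra hxB
    exact hw.2 (hF w ⟨x, hx, hxB⟩)
  let H := Module.finBasis K S
  have hlin : ∀ (l : S →ₗ[K] K) (x : S), l x = ∑ j, H.repr x j * l (H j) := by
    intro l x
    conv_lhs => rw [← H.sum_repr x, map_sum]
    simp only [map_smul, smul_eq_mul]
  have hexp : ∀ (x : S) (w : FreeMonoid β), x.1 w = ∑ j, H.repr x j * (H j).1 w :=
    fun x w => hlin (LinearMap.proj w ∘ₗ S.subtype) x
  -- The parts are the coordinates of the translates of F and the basis functions themselves; the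
  -- auxiliary maps `m` are the matrix entries of the translation operators. All vanish on words
  -- with a letter outside `B`, hence come from polynomial maps.
  choose g hg hgw using fun j => exists_preservesDegree_of_words b (fun u => H.repr (τ u F) j)
    (hfinite _ fun u hu => by rw [hτ0 u hu, map_zero, Finsupp.zero_apply])
  choose h hh hhw using fun j => exists_preservesDegree_of_words b (H j).1 (hfinite _ (hS0 _))
  choose m hm hmw using fun i j => exists_preservesDegree_of_words b
    (fun u => H.repr (τ u (H i)) j)
    (hfinite _ fun u hu => by rw [hτ0 u hu, map_zero, Finsupp.zero_apply])
  -- The matrix entries split the parts once more: coordinates after a second translation, and the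
  -- expansion of a translated basis function.
  refine ⟨_, fun j => ⟨g j, hg j, _, g, fun i => m i j, ?_⟩,
    fun j => ⟨h j, hh j, _, fun i => m j i, h, ?_⟩, ?_⟩
  · refine (polySplit_iff_wordCoef b (hg j) hg fun i => hm i j).2 fun u w => ?_
    simp only [hgw, hmw, hττ]
    exact hlin (H.coord j ∘ₗ τ w) (τ u F)
  · refine (polySplit_iff_wordCoef b (hh j) (hm j) hh).2 fun u w => ?_
    simp only [hhw, hmw]
    exact hexp (τ u (H j)) w
  · refine (polySplit_iff_wordCoef b hd hg hh).2 fun u w => ?_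
    simp only [hhw, hgw]
    exact hexp (τ u F) w

end Translates

/-! ### The coalgebra of representative functions -/

section RepresentativeCoalgebra

variable {K : Type u} [Field K] {A B : Type*} [AddCommGroup A] [Module K A] [AddCommGroup B]
  [Module K B]

/-- In a basis of `A` a tensor is a finitely supported family in `B`, and the functionals detect
each member. -/
theorem tensor_eq_zero_of_lTensor {κ : Type*} (E : κ → B →ₗ[K] K)
    (hE : ∀ y, (∀ j, E j y = 0) → y = 0) (x : A ⊗[K] B)
    (hx : ∀ j, (E j).lTensor A x = 0) : x = 0 := by
  classical
  let a := Module.Basis.ofVectorSpace K A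
  refine (TensorProduct.equivFinsuppOfBasisLeft a).injective ?_
  rw [map_zero]
  ext k
  refine hE _ fun j => ?_
  have : ∀ z : A ⊗[K] B, E j (TensorProduct.equivFinsuppOfBasisLeft a z k) =
      a.coord k (TensorProduct.rid K A ((E j).lTensor A z)) := by
    intro z
    induction z using TensorProduct.induction_on with
    | zero => simp
    | tmul c d => simp [mul_comm]
    | add z z' h h' => simp only [map_add, Finsupp.add_apply, h, h']
  rw [this, hx j, map_zero, map_zero]

/-- Jointly injective families of functionals separate the points of a tensor product. -/
theorem tensor_eq_zero_of_map {κ κ' : Type*} (E : κ → A →ₗ[K] K) (E' : κ' → B →ₗ[K] K)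
    (hE : ∀ y, (∀ j, E j y = 0) → y = 0) (hE' : ∀ y, (∀ j, E' j y = 0) → y = 0) (x : A ⊗[K] B)
    (hx : ∀ i j, LinearMap.mul' K K (TensorProduct.map (E i) (E' j) x) = 0) : x = 0 := by
  refine tensor_eq_zero_of_lTensor E' hE' x fun j => ?_
  refine (TensorProduct.rid K A).injective ?_
  rw [map_zero]
  refine hE _ fun i => ?_
  rw [← hx i j]
  have : ∀ z : A ⊗[K] B, E i (TensorProduct.rid K A ((E' j).lTensor A z)) =
      LinearMap.mul' K K (TensorProduct.map (E i) (E' j) z) := by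
    intro z
    induction z using TensorProduct.induction_on with
    | zero => simp
    | tmul c d => simp [mul_comm]
    | add z z' h h' => simp only [map_add, h, h']
  exact this x

/-- The tensor square of `A` embeds into the functions on M × M, and (u, w) ↦ f(uw) lies in its
image. Coassociativity and counit laws are then the monoid laws, tested on points. -/
theorem exists_coalgebra_of_split_addCommGroup {M : Type*} [Monoid M] (E : M → A →ₗ[K] K)
    (hE : ∀ y, (∀ u, E u y = 0) → y = 0)
    (hs : ∀ f : A, ∃ (n : ℕ) (g h : Fin n → A), ∀ u w, E (u * w) f = ∑ i, E u (g i) * E w (h i)) :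
    ∃ c : Coalgebra K A,
      (∀ (f : A) (n : ℕ) (g h : Fin n → A), (∀ u w, E (u * w) f = ∑ i, E u (g i) * E w (h i)) →
        c.comul f = ∑ i, g i ⊗ₜ[K] h i) ∧ ∀ f, c.counit f = E 1 f := by
  let E₂ : M × M → A ⊗[K] A →ₗ[K] K := fun p =>
    LinearMap.mul' K K ∘ₗ TensorProduct.map (E p.1) (E p.2)
  have hE₂ : ∀ x, (∀ p, E₂ p x = 0) → x = 0 := fun x hx =>
    tensor_eq_zero_of_map E E hE hE x fun i j => hx (i, j)
  let ev : A ⊗[K] A →ₗ[K] (M × M → K) := LinearMap.pi E₂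
  have hev : Function.Injective ev := by
    rw [injective_iff_map_eq_zero]
    exact fun x hx => hE₂ x fun p => congrFun hx p
  let μ : A →ₗ[K] (M × M → K) := LinearMap.pi fun p => E (p.1 * p.2)
  have hsum : ∀ (f : A) (n : ℕ) (g h : Fin n → A),
      (∀ u w, E (u * w) f = ∑ i, E u (g i) * E w (h i)) → ev (∑ i, g i ⊗ₜ[K] h i) = μ f := by
    intro f n g h hf
    funext p
    refine Eq.trans ?_ (hf p.1 p.2).symm
    simp [ev, E₂]
  have hμ : ∀ f, μ f ∈ LinearMap.range ev := by
    intro f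
    obtain ⟨n, g, h, hf⟩ := hs f
    exact ⟨_, hsum f n g h hf⟩
  let δ : A →ₗ[K] A ⊗[K] A :=
    (LinearEquiv.ofInjective ev hev).symm.toLinearMap ∘ₗ μ.codRestrict _ hμ
  have hδ : ∀ f, ev (δ f) = μ f := fun f =>
    congrArg Subtype.val ((LinearEquiv.ofInjective ev hev).apply_symm_apply ⟨μ f, hμ f⟩)
  have hδE : ∀ u w f, E₂ (u, w) (δ f) = E (u * w) f := fun u w f => congrFun (hδ f) (u, w)
  have hδs : ∀ (f : A) (n : ℕ) (g h : Fin n → A),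
      (∀ u w, E (u * w) f = ∑ i, E u (g i) * E w (h i)) → δ f = ∑ i, g i ⊗ₜ[K] h i :=
    fun f n g h hf => hev ((hδ f).trans (hsum f n g h hf).symm)
  refine ⟨{ comul := δ, counit := E 1, coassoc := ?_, rTensor_counit_comp_comul := ?_,
            lTensor_counit_comp_comul := ?_ }, hδs, fun _ => rfl⟩
  · refine LinearMap.ext fun f => sub_eq_zero.1 ?_
    refine tensor_eq_zero_of_map E E₂ hE hE₂ _ fun u p => ?_
    obtain ⟨v, w⟩ := p
    rw [map_sub, map_sub, sub_eq_zero]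
    have h1 : ∀ z : A ⊗[K] A, LinearMap.mul' K K (TensorProduct.map (E u) (E₂ (v, w))
        (TensorProduct.assoc K A A A (δ.rTensor A z))) = E₂ (u * v, w) z := by
      intro z
      induction z using TensorProduct.induction_on with
      | zero => simp
      | add z z' h h' => simp only [map_add, h, h']
      | tmul c d =>
        have h2 : ∀ y : A ⊗[K] A, LinearMap.mul' K K (TensorProduct.map (E u) (E₂ (v, w))
            (TensorProduct.assoc K A A A (y ⊗ₜ d))) = E₂ (u, v) y * E w d := by
          intro y
          induction y using TensorProduct.induction_on with
          | zero => simp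
          | add y y' h h' => simp only [TensorProduct.add_tmul, map_add, h, h', add_mul]
          | tmul y y' => simp [E₂, mul_assoc]
        rw [LinearMap.rTensor_tmul, h2, hδE]
        simp [E₂]
    have h3 : ∀ z : A ⊗[K] A, LinearMap.mul' K K (TensorProduct.map (E u) (E₂ (v, w))
        (δ.lTensor A z)) = E₂ (u, v * w) z := by
      intro z
      induction z using TensorProduct.induction_on with
      | zero => simp
      | add z z' h h' => simp only [map_add, h, h']
      | tmul c d =>
        rw [LinearMap.lTensor_tmul, TensorProduct.map_tmul, hδE]
        simp [E₂]
    refine (h1 _).trans (Eq.trans ?_ (h3 _).symm)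
    rw [hδE, hδE, mul_assoc]
  · refine LinearMap.ext fun f => (TensorProduct.lid K A).injective (sub_eq_zero.1 (hE _ fun u => ?_))
    obtain ⟨n, g, h, hf⟩ := hs f
    have := hf 1 u
    rw [one_mul] at this
    simp [hδs f n g h hf, this]
  · refine LinearMap.ext fun f => (TensorProduct.rid K A).injective (sub_eq_zero.1 (hE _ fun u => ?_))
    obtain ⟨n, g, h, hf⟩ := hs f
    have := hf u 1
    rw [mul_one] at this
    simp [hδs f n g h hf, this, mul_comm]

/-- A space of functions on a monoid that is closed under splitting is a coalgebra. -/
theorem exists_coalgebra_of_split {A : Type*} [AddCommMonoid A] [Module K A]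
    {M : Type*} [Monoid M] (E : M → A →ₗ[K] K)
    (hE : ∀ y, (∀ u, E u y = 0) → y = 0)
    (hs : ∀ f : A, ∃ (n : ℕ) (g h : Fin n → A), ∀ u w, E (u * w) f = ∑ i, E u (g i) * E w (h i)) :
    ∃ c : Coalgebra K A,
      (∀ (f : A) (n : ℕ) (g h : Fin n → A), (∀ u w, E (u * w) f = ∑ i, E u (g i) * E w (h i)) →
        c.comul f = ∑ i, g i ⊗ₜ[K] h i) ∧ ∀ f, c.counit f = E 1 f := by
  -- Negation is taken from the scalar -1, so the given addition remains the underlying one.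
  let _ : AddCommGroup A := Module.addCommMonoidToAddCommGroup K
  exact exists_coalgebra_of_split_addCommGroup E hE hs

variable {V : Type v} [AddCommGroup V] [Module K V] {β : Type*} (b : Module.Basis β K V)

/-- The coefficient functionals on `BLRep K V`. -/
noncomputable def blCoef (w : FreeMonoid β) : BLRep K V →ₗ[K] K :=
  wordCoef b w ∘ₗ (BLRep K V).subtype

theorem blCoef_apply (w : FreeMonoid β) (f : BLRep K V) : blCoef b w f = wordCoef b w f.1 := rfl

theorem eq_zero_of_blCoef (f : BLRep K V) (hf : ∀ w, blCoef b w f = 0) : f = 0 := by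
  have h0 : PreservesDegree (0 : K[X] →ₗ[K] TensorAlgebra K V) := fun _ => zero_mem _
  have : f.1 = 0 := PreservesDegree.ext b f.2.1 h0 fun w => (hf w).trans (map_zero _).symm
  exact Subtype.ext this

theorem polySplit_iff_blCoef (f : BLRep K V) (n : ℕ) (g h : Fin n → BLRep K V) :
    PolySplit f.1 (fun i => (g i).1) (fun i => (h i).1) ↔
      ∀ u w, blCoef b (u * w) f = ∑ i, blCoef b u (g i) * blCoef b w (h i) :=
  polySplit_iff_wordCoef b f.2.1 (fun i => (g i).2.1) (fun i => (h i).2.1)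

theorem algebraMap_blCoef_one (f : BLRep K V) :
    algebraMap K (TensorAlgebra K V) (blCoef b 1 f) = f.1 1 := by
  have h0 := f.2.1 0
  rw [pow_zero, pow_zero, Submodule.mem_one] at h0
  obtain ⟨x, hx⟩ := h0
  have h1 : blCoef b 1 f = b.tensorAlgebra.coord 1 (f.1 1) := by
    rw [blCoef_apply, wordCoef_apply, FreeMonoid.length_one, pow_zero]
  have h2 : b.tensorAlgebra.coord 1 (algebraMap K (TensorAlgebra K V) x) = x := by
    rw [Algebra.algebraMap_eq_smul_one, ← tensorAlgebra_basis_one b, map_smul,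
      Module.Basis.coord_apply, Module.Basis.repr_self, Finsupp.single_eq_same, smul_eq_mul,
      mul_one]
  rw [h1, ← hx, h2]

theorem exists_isBLCoalgebra {β : Type*} (b : Module.Basis β K V) :
    ∃ c : Coalgebra K (BLRep K V), IsBLCoalgebra c := by
  have hs : ∀ f : BLRep K V, ∃ (n : ℕ) (g h : Fin n → BLRep K V),
      ∀ u w, blCoef b (u * w) f = ∑ i, blCoef b u (g i) * blCoef b w (h i) := by
    intro f
    obtain ⟨n, g, h, H⟩ := exists_polySplit_BLRep b f
    exact ⟨n, g, h, (polySplit_iff_blCoef b f n g h).1 H⟩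
  obtain ⟨c, hc, hc1⟩ := exists_coalgebra_of_split (A := BLRep K V) (M := FreeMonoid β)
    (blCoef b) (eq_zero_of_blCoef b) hs
  exact ⟨c, exists_polySplit_BLRep b,
    fun f n g h H => hc f n g h ((polySplit_iff_blCoef b f n g h).1 H),
    fun f => by rw [hc1, algebraMap_blCoef_one]⟩

end RepresentativeCoalgebra

/-! ### Projection tuples and values of generating trees -/

section Projections

variable {K : Type u} [CommRing K] {V : Type v} [AddCommGroup V] [Module K V]

open GenTree

theorem projDeg_append {m n : ℕ} (α : Fin m → Bool) (γ : Fin n → Bool) :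
    projDeg (Fin.append α γ) = projDeg α + projDeg γ := by
  simp only [projDeg, Finset.card_filter, Fin.sum_univ_add, Fin.append_left, Fin.append_right]

theorem projDeg_succ {n : ℕ} (α : Fin (n + 1) → Bool) :
    projDeg α = (if α 0 = true then 1 else 0) + projDeg fun k => α k.succ := by
  simp only [projDeg, Finset.card_filter, Fin.sum_univ_succ]

theorem projDeg_true (n : ℕ) : projDeg (fun _ : Fin n => true) = n := by
  simp [projDeg]

theorem projDeg_false (n : ℕ) : projDeg (fun _ : Fin n => false) = 0 := by
  simp [projDeg]

theorem leaf_comb (n : ℕ) : (GradingTree.comb n).leaf = n + 1 := by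
  induction n with
  | zero => rfl
  | succ n ih => rw [GradingTree.comb, GradingTree.leaf, ih, GradingTree.leaf]

/-- Hence the value of a polynomial map at any power of X can be tested on a tree. -/
theorem exists_projDeg_eq (n : ℕ) : ∃ (t : GradingTree) (α : Fin t.leaf → Bool), projDeg α = n := by
  cases n with
  | zero => exact ⟨.triv, fun _ => false, projDeg_false _⟩
  | succ n => exact ⟨.comb n, fun _ => true, (projDeg_true _).trans (leaf_comb n)⟩

theorem projMul_mem_pow {n : ℕ} (α : Fin n → Bool) (x : Fin n → V × K) :
    projMul α x ∈ LinearMap.range (TensorAlgebra.ι K (M := V)) ^ projDeg α := by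
  rw [projMul_apply]
  induction n with
  | zero => simp [projDeg, Submodule.mem_one]
  | succ n ih =>
    rw [List.ofFn_succ, List.prod_cons, projDeg_succ, pow_add]
    refine Submodule.mul_mem_mul ?_ (ih (fun k => α k.succ) fun k => x k.succ)
    cases h : α 0
    · simp only [Bool.false_eq_true, if_false, pow_zero]
      exact Submodule.mem_one.2 ⟨(x 0).2, rfl⟩
    · simp only [if_true, pow_one]
      exact ⟨(x 0).1, rfl⟩

/-- The linear map on tensors behind `projMul`. -/
noncomputable def projLift {n : ℕ} (α : Fin n → Bool) :
    (⨂[K]^n (V × K)) →ₗ[K] TensorAlgebra K V :=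
  PiTensorProduct.lift (projMul α)

theorem projLift_tprod {n : ℕ} (α : Fin n → Bool) (x : Fin n → V × K) :
    projLift α (PiTensorProduct.tprod K x) = projMul α x :=
  PiTensorProduct.lift.tprod _

theorem treeMul_tprod {t u : GradingTree} (x : Fin t.leaf → V × K) (y : Fin u.leaf → V × K) :
    treeMul (PiTensorProduct.tprod K x : TreePower K (V × K) t)
      (PiTensorProduct.tprod K y : TreePower K (V × K) u) =
      PiTensorProduct.tprod K (Fin.append x y) :=
  TensorPower.tprod_mul_tprod K x y

theorem projMul_append {m n : ℕ} (α : Fin m → Bool) (γ : Fin n → Bool) (x : Fin m → V × K)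
    (y : Fin n → V × K) :
    projMul (Fin.append α γ) (Fin.append x y) = projMul α x * projMul γ y := by
  simp only [projMul_apply, List.ofFn_add, List.prod_append]
  congr 2 <;> simp [Fin.append_right]

/-- The concatenation of projection tuples for two trees. -/
def joinProj {t u : GradingTree} (α : Fin t.leaf → Bool) (γ : Fin u.leaf → Bool) :
    Fin (GradingTree.join t u).leaf → Bool :=
  Fin.append α γ

theorem projDeg_joinProj {t u : GradingTree} (α : Fin t.leaf → Bool) (γ : Fin u.leaf → Bool) :
    projDeg (joinProj α γ) = projDeg α + projDeg γ :=
  projDeg_append α γ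

theorem exists_eq_joinProj {t u : GradingTree} (α : Fin (GradingTree.join t u).leaf → Bool) :
    ∃ (α₁ : Fin t.leaf → Bool) (α₂ : Fin u.leaf → Bool), α = joinProj α₁ α₂ :=
  ⟨fun k => α (Fin.castAdd u.leaf k), fun k => α (Fin.natAdd t.leaf k),
    (Fin.append_castAdd_natAdd (m := t.leaf) (n := u.leaf)).symm⟩

/-- The product of the tree-tensor algebra as a bilinear map. -/
noncomputable def treeMulLin (K : Type u) [CommRing K] (M : Type v) [AddCommGroup M] [Module K M]
    (t u : GradingTree) :
    TreePower K M t →ₗ[K] TreePower K M u →ₗ[K] TreePower K M (GradingTree.join t u) :=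
  (TensorProduct.mk K _ _).compr₂
    (TensorPower.mulEquiv (R := K) (M := M) (n := t.leaf) (m := u.leaf)).toLinearMap

theorem treeMul_eq {M : Type v} [AddCommGroup M] [Module K M] {t u : GradingTree}
    (x : TreePower K M t) (y : TreePower K M u) : treeMul x y = treeMulLin K M t u x y := rfl

theorem projLift_treeMul {t u : GradingTree} (α : Fin t.leaf → Bool) (γ : Fin u.leaf → Bool)
    (x : TreePower K (V × K) t) (y : TreePower K (V × K) u) :
    projLift (joinProj α γ) (treeMul x y) = projLift α x * projLift γ y := by
  induction x using PiTensorProduct.induction_on with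
  | add x x' hx hx' =>
    rw [treeMul_eq, map_add, LinearMap.add_apply, map_add, map_add, add_mul, ← hx, ← hx']
    rfl
  | smul_tprod c x =>
    rw [treeMul_eq, map_smul, LinearMap.smul_apply, map_smul, map_smul, smul_mul_assoc]
    congr 1
    induction y using PiTensorProduct.induction_on with
    | add y y' hy hy' => rw [map_add, map_add, hy, hy', map_add, mul_add]
    | smul_tprod d y =>
      rw [map_smul, map_smul, map_smul, mul_smul_comm, ← treeMul_eq, treeMul_tprod, projLift_tprod,
        projLift_tprod]
      congr 1
      exact (projLift_tprod _ _).trans (projMul_append α γ x y)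

theorem projLift_treeValue (σ : GenTree K V) (t : GradingTree) (α : Fin t.leaf → Bool) :
    projLift α (σ.treeValue t) = σ.projValue t α := by
  rw [projValue_eq, treeValue, leafSum, leafSum, map_sum]
  exact Finset.sum_congr rfl fun ι _ => projLift_tprod _ _

theorem treeValue_join (σ : GenTree K V) (t u : GradingTree) :
    σ.treeValue (.join t u) =
      ∑ i : Fin σ.rootWidth, treeMul ((σ.child .L i).treeValue t) ((σ.child .R i).treeValue u) := by
  rw [treeValue, leafSum_join]
  refine Finset.sum_congr rfl fun i _ => ?_
  rw [treeMul_eq, treeValue, treeValue, leafSum, leafSum, map_sum, LinearMap.sum_apply]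
  refine Finset.sum_congr rfl fun ι _ => ?_
  rw [leafSum, leafSum, map_sum]
  exact Finset.sum_congr rfl fun κ _ => (treeMul_tprod _ _).symm

theorem projValue_join (σ : GenTree K V) (t u : GradingTree) (α : Fin t.leaf → Bool)
    (γ : Fin u.leaf → Bool) :
    σ.projValue (.join t u) (joinProj α γ) =
      ∑ i : Fin σ.rootWidth, (σ.child .L i).projValue t α * (σ.child .R i).projValue u γ := by
  rw [← projLift_treeValue, treeValue_join, map_sum]
  refine Finset.sum_congr rfl fun i _ => ?_
  rw [projLift_treeMul, projLift_treeValue, projLift_treeValue]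

/-- The homomorphism generated by a generating tree. -/
noncomputable def GenTree.toHom (σ : GenTree K V) : TreeHom K V :=
  DirectSum.toModule K GradingTree _ fun t =>
    (PiTensorProduct.lift (MultilinearMap.mkPiAlgebra K (Fin t.leaf) K)).smulRight
      (DirectSum.lof K GradingTree (TreePower K (V × K)) t (σ.treeValue t))

theorem GenTree.generates_toHom (σ : GenTree K V) : σ.Generates σ.toHom := by
  intro t
  rw [GenTree.toHom, treeBasis, DirectSum.toModule_lof]
  simp

theorem GenTree.Generates.value {σ : GenTree K V} {f : TreeHom K V} (h : σ.Generates f)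
    (t : GradingTree) : f.value t = σ.treeValue t := by
  rw [TreeHom.value, h t, DirectSum.component.lof_self]

/-- Each tensor power of `K` is spanned by 1 ⊗ ⋯ ⊗ 1. -/
theorem treeHom_ext {f g : TreeHom K V} (h : ∀ t, f (treeBasis K t) = g (treeBasis K t)) :
    f = g := by
  refine DirectSum.linearMap_ext K fun t => PiTensorProduct.ext (MultilinearMap.ext fun x => ?_)
  have hx : PiTensorProduct.tprod K x =
      (∏ k, x k) • PiTensorProduct.tprod K fun _ : Fin t.leaf => (1 : K) := by
    rw [← MultilinearMap.map_smul_univ]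
    simp
  simp only [LinearMap.compMultilinearMap_apply, LinearMap.comp_apply]
  rw [hx]
  simp only [map_smul]
  congr 1
  exact h t

variable {β : Type*} (b : Module.Basis β K V)

theorem coord_of_ι (i : β) (v : V) :
    b.tensorAlgebra.coord (FreeMonoid.of i) (TensorAlgebra.ι K v) = b.repr v i := by
  classical
  suffices b.tensorAlgebra.coord (FreeMonoid.of i) ∘ₗ TensorAlgebra.ι K = b.coord i from
    LinearMap.congr_fun this v
  refine b.ext fun j => ?_
  rw [LinearMap.comp_apply, ← tensorAlgebra_basis_of, Module.Basis.coord_apply,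
    Module.Basis.coord_apply, Module.Basis.repr_self, Module.Basis.repr_self, Finsupp.single_apply,
    Finsupp.single_apply]
  exact if_congr FreeMonoid.of_injective.eq_iff rfl rfl

/-- The index `p` of a basis tensor of (V ⊕ K)^{⊗n} amounts to a projection tuple, telling which
factors lie in V, together with the word of its letters from `β`; factors from `K` become scalars.
-/
theorem coord_projMul {n : ℕ} (p : Fin n → β ⊕ Unit) (y : Fin n → V × K) :
    b.tensorAlgebra.coord (FreeMonoid.ofList ((List.ofFn p).filterMap Sum.getLeft?))
      (projMul (fun k => (p k).isLeft) y) =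
      ∏ k, (b.prod (Module.Basis.singleton Unit K)).repr (y k) (p k) := by
  simp only [projMul_apply]
  induction n with
  | zero =>
    simp only [List.ofFn_zero, List.filterMap_nil, List.prod_nil, FreeMonoid.ofList_nil,
      Finset.univ_eq_empty, Finset.prod_empty]
    rw [← tensorAlgebra_basis_one b, Module.Basis.coord_apply, Module.Basis.repr_self,
      Finsupp.single_eq_same]
  | succ n ih =>
    rw [List.ofFn_succ, List.ofFn_succ, List.prod_cons, Fin.prod_univ_succ,
      ← ih (fun k => p k.succ) fun k => y k.succ]
    rcases h : p 0 with i | i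
    · rw [List.filterMap_cons_some (f := Sum.getLeft?) (b := i) rfl, FreeMonoid.ofList_cons, coord_mul_of_mem_pow]
      · congr 1
        simp only [Sum.isLeft_inl, projTo, LinearMap.comp_apply, LinearMap.fst_apply, coord_of_ι]
        simp
      · rw [FreeMonoid.length_of, pow_one]
        exact ⟨(y 0).1, rfl⟩
    · rw [List.filterMap_cons_none (f := Sum.getLeft?) rfl]
      simp only [Sum.isLeft_inr, projTo, LinearMap.comp_apply, LinearMap.snd_apply,
        Algebra.linearMap_apply, ← Algebra.smul_def, map_smul, smul_eq_mul]
      congr 1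
      simp

/-- A tensor over `V ⊕ K` is determined by its images under the projection tuples. -/
theorem eq_of_projLift {β : Type*} (b : Module.Basis β K V) {n : ℕ} {x y : ⨂[K]^n (V × K)}
    (h : ∀ α : Fin n → Bool, projLift α x = projLift α y) : x = y := by
  let P := Basis.piTensorProduct fun _ : Fin n => b.prod (Module.Basis.singleton Unit K)
  have key : ∀ p, P.coord p =
      b.tensorAlgebra.coord (FreeMonoid.ofList ((List.ofFn p).filterMap Sum.getLeft?)) ∘ₗ
        projLift fun k => (p k).isLeft := by
    intro p
    refine PiTensorProduct.ext (MultilinearMap.ext fun z => ?_)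
    simp only [LinearMap.compMultilinearMap_apply, LinearMap.comp_apply]
    rw [projLift_tprod, coord_projMul]
    exact Basis.piTensorProduct_repr_tprod_apply _ _ _
  refine P.ext_elem fun p => ?_
  have hx := LinearMap.congr_fun (key p) x
  have hy := LinearMap.congr_fun (key p) y
  rw [LinearMap.comp_apply, h] at hx
  exact hx.trans hy.symm

end Projections

/-! ### The comparison map and its injectivity -/

section Comparison

variable {K : Type u} [CommRing K] {V : Type v} [AddCommGroup V] [Module K V]

open GenTree

theorem value_add (f g : TreeHom K V) (t : GradingTree) :
    (f + g).value t = f.value t + g.value t := by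
  simp only [TreeHom.value, LinearMap.add_apply, map_add]

theorem value_smul (c : K) (f : TreeHom K V) (t : GradingTree) :
    (c • f).value t = c • f.value t := by
  simp only [TreeHom.value, LinearMap.smul_apply, map_smul]

theorem combValue_zero_eq (f : TreeHom K V) :
    combValue f 0 = projLift (fun _ => false) (f.value .triv) := by
  have : ∀ x : ⨂[K]^1 (V × K), algebraMap K (TensorAlgebra K V)
      (PiTensorProduct.subsingletonEquiv (R := K) (s := fun _ : Fin 1 => V × K) (0 : Fin 1) x).2 =
      projLift (fun _ : Fin 1 => false) x := by
    intro x
    induction x using PiTensorProduct.induction_on with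
    | smul_tprod c x =>
      simp [projLift_tprod, projMul_apply, projTo, Algebra.smul_def]
    | add x y hx hy => simp only [map_add, Prod.snd_add, hx, hy]
  exact this (f.value .triv)

theorem combValue_succ_eq (f : TreeHom K V) (n : ℕ) :
    combValue f (n + 1) = projLift (fun _ => true) (f.value (.comb n)) := by
  have : ∀ (m : ℕ) (x : ⨂[K]^m (V × K)), TensorPower.toTensorAlgebra
      (PiTensorProduct.map (fun _ => LinearMap.fst K V K) x) = projLift (fun _ => true) x := by
    intro m x
    induction x using PiTensorProduct.induction_on with
    | smul_tprod c x =>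
      simp [projLift_tprod, projMul_apply, projTo, PiTensorProduct.map_tprod,
        TensorAlgebra.tprod_apply]
    | add x y hx hy => simp only [map_add, hx, hy]
  exact this _ _

theorem ι_rootValue_fst (f : TreeHom K V) :
    TensorAlgebra.ι K f.rootValue.1 = combValue f 1 := by
  have : ∀ x : ⨂[K]^1 (V × K), TensorAlgebra.ι K
      (PiTensorProduct.subsingletonEquiv (R := K) (s := fun _ : Fin 1 => V × K) (0 : Fin 1) x).1 =
      projLift (fun _ : Fin 1 => true) x := by
    intro x
    induction x using PiTensorProduct.induction_on with
    | smul_tprod c x => simp [projLift_tprod, projMul_apply, projTo]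
    | add x y hx hy => simp only [map_add, Prod.fst_add, hx, hy]
  rw [combValue_succ_eq]
  exact this (f.value .triv)

/-- The polynomial map attached to a homomorphism of tree-tensor algebras. -/
noncomputable def combMap (K : Type u) [CommRing K] (V : Type v) [AddCommGroup V] [Module K V] :
    TreeHom K V →ₗ[K] (K[X] →ₗ[K] TensorAlgebra K V) where
  toFun f := (Polynomial.basisMonomials K).constr K (combValue f)
  map_add' f g := by
    rw [← map_add]
    congr 1
    funext n
    cases n with
    | zero => simp only [Pi.add_apply, combValue_zero_eq, value_add, map_add]
    | succ n => simp only [Pi.add_apply, combValue_succ_eq, value_add, map_add]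
  map_smul' c f := by
    rw [RingHom.id_apply, ← map_smul]
    congr 1
    funext n
    cases n with
    | zero => simp only [Pi.smul_apply, combValue_zero_eq, value_smul, map_smul]
    | succ n => simp only [Pi.smul_apply, combValue_succ_eq, value_smul, map_smul]

theorem combMap_X_pow (f : TreeHom K V) (n : ℕ) :
    combMap K V f (Polynomial.X ^ n) = combValue f n := by
  rw [Polynomial.X_pow_eq_monomial]
  exact Module.Basis.constr_basis (Polynomial.basisMonomials K) K _ n

/-- Weak normality exchanges the comb with all factors projected to V, or the trivial tree projected
to K in degree 0, for any tree and tuple of the same degree. -/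
theorem combMap_eq_projValue {f : TreeHom K V} {σ : GenTree K V} (hσ : σ.Normal)
    (hf : σ.Generates f) (t : GradingTree) (α : Fin t.leaf → Bool) :
    combMap K V f (Polynomial.X ^ projDeg α) = σ.projValue t α := by
  have hw : σ.WeaklyNormal := ((normal_iff σ).1 hσ).1
  rw [combMap_X_pow]
  cases h : projDeg α with
  | zero =>
    rw [combValue_zero_eq, hf.value, projLift_treeValue]
    exact hw _ _ _ _ ((projDeg_false _).trans h.symm)
  | succ n =>
    rw [combValue_succ_eq, hf.value, projLift_treeValue]
    exact hw _ _ _ _ (((projDeg_true _).trans (leaf_comb n)).trans h.symm)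

theorem combMap_eq_projLift {f : TreeHom K V} (hf : f ∈ Nor K V) (t : GradingTree)
    (α : Fin t.leaf → Bool) :
    combMap K V f (Polynomial.X ^ projDeg α) = projLift α (f.value t) := by
  obtain ⟨σ, hσ, hg⟩ := hf
  rw [combMap_eq_projValue hσ hg, hg.value, projLift_treeValue]

theorem preservesDegree_combMap {f : TreeHom K V} (hf : f ∈ Nor K V) :
    PreservesDegree (combMap K V f) := by
  intro n
  obtain ⟨t, α, rfl⟩ := exists_projDeg_eq n
  obtain ⟨σ, hσ, hg⟩ := hf
  rw [combMap_eq_projValue hσ hg, projValue_eq]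
  exact Submodule.sum_mem _ fun ι _ => projMul_mem_pow _ _

/-- The value at X^(k+l) may be computed on a joined tree whose two sides have degrees k and l,
where the tree splitting applies. -/
theorem TreeSplit.polySplit {f : TreeHom K V} (hf : f ∈ Nor K V) {n : ℕ}
    {g h : Fin n → TreeHom K V} (hg : ∀ i, g i ∈ Nor K V) (hh : ∀ i, h i ∈ Nor K V)
    (H : TreeSplit f g h) :
    PolySplit (combMap K V f) (fun i => combMap K V (g i)) (fun i => combMap K V (h i)) := by
  refine PolySplit.of_pow fun k l => ?_
  obtain ⟨t, α, rfl⟩ := exists_projDeg_eq k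
  obtain ⟨u, γ, rfl⟩ := exists_projDeg_eq l
  rw [← projDeg_joinProj, combMap_eq_projLift hf, H t u, map_sum]
  refine Finset.sum_congr rfl fun i _ => ?_
  rw [projLift_treeMul, combMap_eq_projLift (hg i), combMap_eq_projLift (hh i)]

/-- The left and right children of the root of a normal generating tree are normal and generate the
two families. -/
theorem exists_treeSplit (f : Nor K V) : ∃ (n : ℕ) (g h : Fin n → Nor K V),
    TreeSplit f.1 (fun i => (g i).1) (fun i => (h i).1) := by
  obtain ⟨f, σ, hσ, hf⟩ := f
  have hc := ((normal_iff σ).1 hσ).2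
  refine ⟨σ.rootWidth, fun i => ⟨(σ.child .L i).toHom, _, hc .L i i.2, generates_toHom _⟩,
    fun i => ⟨(σ.child .R i).toHom, _, hc .R i i.2, generates_toHom _⟩, fun t u => ?_⟩
  rw [hf.value, treeValue_join]
  refine Finset.sum_congr rfl fun i _ => ?_
  rw [(generates_toHom _).value, (generates_toHom _).value]

theorem combMap_mem_BLRep (f : Nor K V) : combMap K V f.1 ∈ BLRep K V := by
  obtain ⟨n, g, h, H⟩ := exists_treeSplit f
  exact ⟨preservesDegree_combMap f.2, n, _, _, H.polySplit f.2 (fun i => (g i).2) fun i => (h i).2⟩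

/-- The comparison map from normal homomorphisms to representative maps. -/
noncomputable def norToBL (K : Type u) [CommRing K] (V : Type v) [AddCommGroup V] [Module K V] :
    Nor K V →ₗ[K] BLRep K V :=
  (combMap K V ∘ₗ (Nor K V).subtype).codRestrict _ combMap_mem_BLRep

theorem norToBL_apply (f : Nor K V) : (norToBL K V f).1 = combMap K V f.1 := rfl

/-- By normality the polynomial map knows all projections of every f(t), and these determine f(t).
-/
theorem norToBL_injective {β : Type*} (b : Module.Basis β K V) :
    Function.Injective (norToBL K V) := by
  intro f g hfg
  refine Subtype.ext (treeHom_ext fun t => ?_)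
  have hfg' : combMap K V f.1 = combMap K V g.1 := congrArg Subtype.val hfg
  have hv : f.1.value t = g.1.value t := eq_of_projLift b fun α => by
    rw [← combMap_eq_projLift f.2, ← combMap_eq_projLift g.2, hfg']
  obtain ⟨σ, hσ, hf⟩ := f.2
  obtain ⟨τ, hτ, hg⟩ := g.2
  rw [hf t, hg t, ← hf.value, ← hg.value, hv]

end Comparison

/-! ### Surjectivity by iterated splitting, and the coalgebra isomorphism -/

section Surjectivity

variable {K : Type u} [Field K] {V : Type v} [AddCommGroup V] [Module K V]

open GenTree

/-- A zero term is appended because nodes must have children; the families are extended by zero to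
all of ℕ because positions carry arbitrary numbers. -/
theorem exists_polySplit_BLRep_pos (f : BLRep K V) : ∃ (n : ℕ) (g h : ℕ → BLRep K V), 0 < n ∧
    PolySplit f.1 (fun i : Fin n => (g i).1) (fun i : Fin n => (h i).1) := by
  obtain ⟨n, g, h, H⟩ := exists_polySplit_BLRep (Module.Basis.ofVectorSpace K V) f
  refine ⟨n + 1, fun i => if hi : i < n then g ⟨i, hi⟩ else 0,
    fun i => if hi : i < n then h ⟨i, hi⟩ else 0, Nat.succ_pos n, fun p q => ?_⟩
  rw [H p q, Fin.sum_univ_castSucc]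
  simp

variable (K V) in
/-- A choice of a splitting for every representative map. -/
structure BLSplitting where
  width : BLRep K V → ℕ
  part : Side → BLRep K V → ℕ → BLRep K V
  width_pos : ∀ f, 0 < width f
  split : ∀ f, PolySplit f.1 (fun i : Fin (width f) => (part .L f i).1)
    (fun i : Fin (width f) => (part .R f i).1)

theorem nonempty_BLSplitting : Nonempty (BLSplitting K V) := by
  choose n g h hn H using exists_polySplit_BLRep_pos (K := K) (V := V)
  exact ⟨⟨n, fun d => match d with
    | .L => g
    | .R => h, hn, H⟩⟩

namespace BLSplitting

variable (S : BLSplitting K V)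

/-- The representative map at a position, in iterated splittings of `f`. -/
def state (f : BLRep K V) : Position → BLRep K V
  | [] => f
  | (d, i) :: r => state (S.part d f i) r

/-- The generating tree of iterated splittings of `f`. -/
noncomputable def tree (f : BLRep K V) : GenTree K V where
  width r := S.width (S.state f r)
  width_pos _ := S.width_pos _
  label r := (blProj (S.state f r), TensorAlgebra.algebraMapInv ((S.state f r).1 1))

theorem child_tree (f : BLRep K V) (d : Side) (i : ℕ) :
    (S.tree f).child d i = S.tree (S.part d f i) := rfl

/-- At a leaf the label stores exactly f(X) and f(1), and at an inner node the chosen splitting is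
applied to a product of powers of X. The shape of `t` thus drops out, which is normality. -/
theorem projValue_tree (t : GradingTree) : ∀ (f : BLRep K V) (α : Fin t.leaf → Bool),
    (S.tree f).projValue t α = f.1 (Polynomial.X ^ projDeg α) := by
  induction t with
  | triv =>
    intro f α
    have h1 : (S.tree f).projValue .triv α = projTo K V (α ⟨0, Nat.one_pos⟩) ((S.tree f).label []) := by
      rw [projValue, leafSum_triv]
      exact List.prod_singleton
    have h2 : projDeg α = if α ⟨0, Nat.one_pos⟩ = true then 1 else 0 := (projDeg_succ (n := 0) α).trans rfl
    rw [h1, h2]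
    cases α ⟨0, Nat.one_pos⟩
    · simp only [Bool.false_eq_true, if_false, pow_zero]
      have h0 := f.2.1 0
      rw [pow_zero, pow_zero, Submodule.mem_one] at h0
      obtain ⟨x, hx⟩ := h0
      change algebraMap K _ (TensorAlgebra.algebraMapInv (f.1 1)) = f.1 1
      rw [← hx, TensorAlgebra.algebraMap_leftInverse]
    · simp only [if_true, pow_one]
      exact ι_blProj f
  | join t u iht ihu =>
    intro f α
    obtain ⟨α₁, α₂, rfl⟩ := exists_eq_joinProj α
    rw [projValue_join, projDeg_joinProj, pow_add, S.split f]
    refine Finset.sum_congr rfl fun i _ => ?_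
    rw [child_tree, child_tree, iht, ihu]

theorem normal_tree (f : BLRep K V) : (S.tree f).Normal := by
  intro s
  induction s generalizing f with
  | nil =>
    intro _ t u α γ h
    rw [subtree_nil, projValue_tree, projValue_tree, h]
  | cons p s ih =>
    intro hs
    exact ih (S.part p.1 f p.2) hs.2

end BLSplitting

theorem norToBL_surjective : Function.Surjective (norToBL K V) := by
  intro f
  obtain ⟨S⟩ := nonempty_BLSplitting (K := K) (V := V)
  have hN := S.normal_tree f
  refine ⟨⟨(S.tree f).toHom, _, hN, generates_toHom _⟩, Subtype.ext ?_⟩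
  refine Polynomial.lhom_ext' fun n => LinearMap.ext_ring ?_
  obtain ⟨t, α, rfl⟩ := exists_projDeg_eq n
  have := combMap_eq_projValue hN (generates_toHom _) t α
  rw [S.projValue_tree] at this
  simpa [← Polynomial.X_pow_eq_monomial, norToBL_apply] using this

variable {β : Type*} (b : Module.Basis β K V)

/-- The coefficient functionals on `Nor K V`. -/
noncomputable def norCoef (w : FreeMonoid β) : Nor K V →ₗ[K] K := blCoef b w ∘ₗ norToBL K V

theorem norCoef_apply (w : FreeMonoid β) (f : Nor K V) :
    norCoef b w f = blCoef b w (norToBL K V f) := rfl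

theorem eq_zero_of_norCoef (f : Nor K V) (hf : ∀ w, norCoef b w f = 0) : f = 0 :=
  norToBL_injective b ((eq_zero_of_blCoef b _ hf).trans (map_zero (norToBL K V)).symm)

theorem norToBL_polySplit {f : Nor K V} {n : ℕ} {g h : Fin n → Nor K V}
    (H : TreeSplit f.1 (fun i => (g i).1) (fun i => (h i).1)) :
    PolySplit (norToBL K V f).1 (fun i => (norToBL K V (g i)).1)
      (fun i => (norToBL K V (h i)).1) :=
  H.polySplit f.2 (fun i => (g i).2) fun i => (h i).2

/-- Pulled back along the comparison map, the word coefficients turn tree splittings into splittings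
of functions on a free monoid, as the general coalgebra construction requires. -/
theorem norCoef_mul {f : Nor K V} {n : ℕ} {g h : Fin n → Nor K V}
    (H : TreeSplit f.1 (fun i => (g i).1) (fun i => (h i).1)) (u w : FreeMonoid β) :
    norCoef b (u * w) f = ∑ i, norCoef b u (g i) * norCoef b w (h i) :=
  (polySplit_iff_blCoef b _ n _ _).1 (norToBL_polySplit H) u w

theorem norCoef_one (f : Nor K V) : norCoef b 1 f = f.1.rootValue.2 := by
  refine (TensorAlgebra.algebraMap_inj V _ _).1 ?_
  rw [norCoef_apply, algebraMap_blCoef_one, norToBL_apply, ← pow_zero Polynomial.X, combMap_X_pow,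
    combValue]

theorem exists_isNorCoalgebra {β : Type*} (b : Module.Basis β K V) :
    ∃ c : Coalgebra K (Nor K V), IsNorCoalgebra c := by
  have hs : ∀ f : Nor K V, ∃ (n : ℕ) (g h : Fin n → Nor K V),
      ∀ u w, norCoef b (u * w) f = ∑ i, norCoef b u (g i) * norCoef b w (h i) := by
    intro f
    obtain ⟨n, g, h, H⟩ := exists_treeSplit f
    exact ⟨n, g, h, norCoef_mul b H⟩
  obtain ⟨c, hc, hc1⟩ := exists_coalgebra_of_split (A := Nor K V) (M := FreeMonoid β)
    (norCoef b) (eq_zero_of_norCoef b) hs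
  exact ⟨c, exists_treeSplit, fun f n g h H => hc f n g h (norCoef_mul b H),
    fun f => by rw [hc1, norCoef_one]⟩

/-- The comparison map is an isomorphism of coalgebras. -/
theorem exists_coalgEquiv (cN : Coalgebra K (Nor K V)) (cB : Coalgebra K (BLRep K V))
    (hN : IsNorCoalgebra cN) (hB : IsBLCoalgebra cB) :
    ∃ φ : Nor K V ≃ₗc[K] BLRep K V, ∀ f, φ f = norToBL K V f := by
  let e : Nor K V ≃ₗ[K] BLRep K V := LinearEquiv.ofBijective (norToBL K V)
    ⟨norToBL_injective (Module.Basis.ofVectorSpace K V), norToBL_surjective⟩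
  have h0 : cB.counit ∘ₗ norToBL K V = cN.counit := by
    refine LinearMap.ext fun f => (TensorAlgebra.algebraMap_inj V _ _).1 ?_
    rw [LinearMap.comp_apply, hB.counit_eq, hN.counit_eq, norToBL_apply,
      ← pow_zero Polynomial.X, combMap_X_pow, combValue]
  have h1 : TensorProduct.map (norToBL K V) (norToBL K V) ∘ₗ cN.comul =
      cB.comul ∘ₗ norToBL K V := by
    refine LinearMap.ext fun f => ?_
    -- One tree splitting and its image determine both comultiplications, since each is prescribed
    -- on every splitting.
    obtain ⟨n, g, h, H⟩ := hN.exists_split f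
    rw [LinearMap.comp_apply, LinearMap.comp_apply, hN.comul_eq f n g h H,
      hB.comul_eq _ n _ _ (norToBL_polySplit H), map_sum]
    rfl
  exact ⟨⟨⟨norToBL K V, h0, h1⟩, e.symm, e.left_inv, e.right_inv⟩, fun _ => rfl⟩

end Surjectivity

/-! ### The main theorem -/

theorem mainTheorem3 (K : Type u) [Field K] (V : Type v) [AddCommGroup V] [Module K V] :
    ∃ (cN : Coalgebra K (Nor K V)) (cB : Coalgebra K (BLRep K V)),
      IsNorCoalgebra cN ∧ IsBLCoalgebra cB ∧
      ∃ φ : Nor K V ≃ₗc[K] BLRep K V,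
        (∀ (f : Nor K V) (n : ℕ), (φ f).1 (Polynomial.X ^ n) = combValue f.1 n) ∧
        (∀ (f : Nor K V) (σ : GenTree K V), σ.Normal → σ.Generates f.1 →
          ∀ (t : GradingTree) (α : Fin t.leaf → Bool),
            (φ f).1 (Polynomial.X ^ GenTree.projDeg α) = σ.projValue t α) ∧
        (∀ f : Nor K V, blProj (φ f) = norProj f) := by
  obtain ⟨cN, hN⟩ := exists_isNorCoalgebra (Module.Basis.ofVectorSpace K V)
  obtain ⟨cB, hB⟩ := exists_isBLCoalgebra (Module.Basis.ofVectorSpace K V)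
  obtain ⟨φ, hφ⟩ := exists_coalgEquiv cN cB hN hB
  refine ⟨cN, cB, hN, hB, φ, fun f n => ?_, fun f σ hσ hf t α => ?_, fun f => ?_⟩
  · rw [hφ, norToBL_apply, combMap_X_pow]
  · rw [hφ, norToBL_apply, combMap_eq_projValue hσ hf]
  · refine (TensorAlgebra.ι_leftInverse (R := K) (M := V)).injective ?_
    rw [ι_blProj, hφ, norProj, ι_rootValue_fst, norToBL_apply, ← combMap_X_pow, pow_one]
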